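/- **Setting.** Let $\mathcal P=(\mathcal P,d,\mu)$ be a metric space with a positive complete Borel measure $\mu$ (extended to all subsets as an outer measure) such that $0<\mu(B)<\infty$ for every ball $B$. Functions $u:\mathcal P\to[-\infty,\infty]$ are defined everywhere; $\|u\|_\infty$ is the essential supremum of $|u|$, and $L^\infty(\mathcal P)$ is the set of measurable $u$ with $\|u\|_\infty<\infty$. Rectifiable curves are parametrized by arc length. We say that there are *$L^\infty$-almost no nonconstant rectifiable curves* in $\mathcal P$ if there is a Borel function $\rho:\mathcal P\to[0,\infty]$ with $\|\rho\|_\infty<\infty$ such that $\int_\gamma\rho\,ds=\infty$ for every nonconstant rectifiable curve $\gamma$ in $\mathcal P$. A Borel function $g:\mathcal P\to[0,\infty]$ is an *upper gradient* of $u$ if $|u(\gamma(0))-u(\gamma(l_\gamma))|\le\int_\gamma g\,ds$ for every nonconstant rectifiable curve $\gamma:[0,l_\gamma]\to\mathcal P$, where $|(\pm\infty)-(\pm\infty)|=\infty$. Let $$\|u\|_{N^{1,\infty}}=\|u\|_\infty+\inf_g\|g\|_\infty,$$ the infimum being over all upper gradients $g$ of $u$, let $N^{1,\infty}(\mathcal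 P)=\{u\in L^\infty(\mathcal P):\|u\|_{N^{1,\infty}}<\infty\}$, and for $E\subset\mathcal P$ let $$C_\infty(E)=\inf\{\|u\|_{N^{1,\infty}}:u\in N^{1,\infty}(\mathcal P),\ u\ge1\text{ on }E\}.$$ $C_\infty$ is an *outer capacity* if $\inf_{G\supset E,\ G\text{ open}}C_\infty(G)\le C_\infty(E)$ for every $E\subset\mathcal P$; it is an *outer capacity for sets of zero capacity* if whenever $C_\infty(E)=0$ and $\varepsilon>0$ there is an open $G\supset E$ with $C_\infty(G)<\varepsilon$. A function $u:\mathcal P\to[-\infty,\infty]$ is *weakly quasicontinuous* if for every $\varepsilon>0$ there is $E\subset\mathcal P$ with $C_\infty(E)<\varepsilon$ such that $u|_{\mathcal P\setminus E}$ is real-valued and continuous; it is *quasicontinuous* if $E$ can moreover be chosen open for every $\varepsilon>0$. **Theorem.** Assume that there are $L^\infty$-almost no nonconstant rectifiable curves in $\mathcal P$ and that $x_0\in\mathcal P$ is a point with $\mu(\{x_0\})=0$. Then $N^{1,\infty}(\mathcal P)=L^\infty(\mathcal P)$, with $\|u\|_{N^{1,\infty}}=\|u\|_\infty$ for all $u \in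 L^\infty(\mathcal P)$, and the following are true: (a) $\chi_{\{x_0\}}\in N^{1,\infty}(\mathcal P)$ is weakly quasicontinuous, but not quasicontinuous. (b) $C_\infty$ is not an outer capacity, not even for sets of zero capacity. (c) If $F\subset\mathcal P$ is a closed set with empty interior and $\mu(F)>0$, then $\chi_F\in N^{1,\infty}(\mathcal P)$ is not weakly quasicontinuous. In particular, all of these facts hold if $\mathcal P$ is the von Koch snowflake curve (either the von Koch curve over a segment, or the closed curve consisting of its three copies placed outwards on the sides of an equilateral triangle) with the Euclidean metric and the $\frac{\log4}{\log3}$-dimensional Hausdorff measure $\mu$: then every ball has positive finite measure, there are $L^\infty$-almost no nonconstant rectifiable curves, $\mu(\{x_0\})=0$ for every $x_0\in\mathcal P$, there is a closed set $F$ with empty interior and $\mu(F)>0$, and hence the conclusions above, including (a) for every $x_0$, (b), and (c) for every such $F$, are true. -/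

import Mathlib

open Set MeasureTheory TopologicalSpace
open scoped ENNReal NNReal

noncomputable section

namespace NewtonLInfty

/-! ### Newtonian spaces based on `L^∞`

`P` is a metric space and `μ` is a measure on a σ-algebra containing all Borel sets.
The complete Borel measure of the theory is the completion of `μ`:
`NullMeasurable f μ` says that `f` is measurable with respect to that completion, and `μ E` is
the outer measure for an arbitrary set `E`. If `μ` is already complete,
`NullMeasurable f μ` is the same as `Measurable f`. -/

section Newtonian

variable {P : Type*} [MetricSpace P]

/-- A nonconstant rectifiable curve in `P`, parametrized by arc length on `[0, length]`.
Unit speed makes the map 1-Lipschitz, hence continuous, on this interval; values of `toFun`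
outside the interval play no role. -/
structure RectCurve (P : Type*) [MetricSpace P] where
  length : ℝ
  length_pos : 0 < length
  toFun : ℝ → P
  unitSpeed : HasUnitSpeedOn toFun (Icc 0 length)

/-- The curve integral `∫_γ ρ ds`. -/
def RectCurve.integral (γ : RectCurve P) (ρ : P → ℝ≥0∞) : ℝ≥0∞ :=
  ∫⁻ t in Icc 0 γ.length, ρ (γ.toFun t)

/-- `g : P → [0,∞]` is a Borel function (for the Borel σ-algebra of the metric space). -/
def IsBorelFun (g : P → ℝ≥0∞) : Prop :=
  @Measurable P ℝ≥0∞ (borel P) _ g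

/-- `g` is an upper gradient of `u : P → [-∞,∞]`. In `EReal` one has `⊤ - ⊤ = ⊥ - ⊥ = ⊥`, and
`|⊥| = ∞`, so that the convention `|(±∞) - (±∞)| = ∞` is in force
(see `abs_top_sub_top` and `abs_bot_sub_bot`). -/
def IsUpperGradient (g : P → ℝ≥0∞) (u : P → EReal) : Prop :=
  IsBorelFun g ∧
    ∀ γ : RectCurve P, (u (γ.toFun 0) - u (γ.toFun γ.length)).abs ≤ γ.integral g

theorem abs_top_sub_top : ((⊤ : EReal) - ⊤).abs = ∞ := by
  simp

theorem abs_bot_sub_bot : ((⊥ : EReal) - ⊥).abs = ∞ := by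
  simp

variable [MeasurableSpace P]

/-- A family `Γ` of nonconstant rectifiable curves has zero `L^∞`-modulus: there is a Borel
function `ρ ≥ 0` in `L^∞` with `∫_γ ρ ds = ∞` for every `γ ∈ Γ`. -/
def ZeroModulus (μ : Measure P) (Γ : Set (RectCurve P)) : Prop :=
  ∃ ρ : P → ℝ≥0∞, IsBorelFun ρ ∧ essSup ρ μ < ∞ ∧ ∀ γ ∈ Γ, γ.integral ρ = ∞

/-- There are `L^∞`-almost no nonconstant rectifiable curves in `P`. -/
def AlmostNoRectCurves (μ : Measure P) : Prop :=
  ZeroModulus μ (univ : Set (RectCurve P))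

/-- The `L^∞`-seminorm of an extended real-valued function. -/
def supNorm (μ : Measure P) (u : P → EReal) : ℝ≥0∞ :=
  essSup (fun x => (u x).abs) μ

/-- `L^∞(P)`, as a space of functions that are defined everywhere. -/
def LInfty (μ : Measure P) : Set (P → EReal) :=
  {u | NullMeasurable u μ ∧ supNorm μ u < ∞}

/-- The Newtonian seminorm `‖u‖_∞ + inf ‖g‖_∞` over all upper gradients `g` of `u`. -/
def newtonNorm (μ : Measure P) (u : P → EReal) : ℝ≥0∞ :=
  supNorm μ u + ⨅ (g : P → ℝ≥0∞) (_ : IsUpperGradient g u), essSup g μ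

/-- The Newtonian space `N^{1,∞}(P)`. -/
def N1Infty (μ : Measure P) : Set (P → EReal) :=
  {u | u ∈ LInfty μ ∧ newtonNorm μ u < ∞}

/-- The Sobolev capacity `C_∞`. -/
def capacity (μ : Measure P) (E : Set P) : ℝ≥0∞ :=
  ⨅ (u : P → EReal) (_ : u ∈ N1Infty μ ∧ ∀ x ∈ E, 1 ≤ u x), newtonNorm μ u

/-- `C_∞` is an outer capacity. -/
def IsOuterCapacity (μ : Measure P) : Prop :=
  ∀ E : Set P, (⨅ (G : Set P) (_ : IsOpen G ∧ E ⊆ G), capacity μ G) ≤ capacity μ E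

/-- `C_∞` is an outer capacity for sets of zero capacity. -/
def IsOuterForZeroSets (μ : Measure P) : Prop :=
  ∀ E : Set P, capacity μ E = 0 → ∀ ε : ℝ≥0∞, 0 < ε →
    ∃ G : Set P, IsOpen G ∧ E ⊆ G ∧ capacity μ G < ε

/-- The restriction of `u` to `A` is a (real-valued) continuous function. -/
def IsRealContinuousOn (u : P → EReal) (A : Set P) : Prop :=
  ContinuousOn u A ∧ ∀ x ∈ A, u x ≠ ⊤ ∧ u x ≠ ⊥

/-- `u` is weakly quasicontinuous. -/
def WeaklyQuasicontinuous (μ : Measure P) (u : P → EReal) : Prop :=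
  ∀ ε : ℝ≥0∞, 0 < ε → ∃ E : Set P, capacity μ E < ε ∧ IsRealContinuousOn u Eᶜ

/-- `u` is quasicontinuous. -/
def Quasicontinuous (μ : Measure P) (u : P → EReal) : Prop :=
  ∀ ε : ℝ≥0∞, 0 < ε → ∃ E : Set P, IsOpen E ∧ capacity μ E < ε ∧ IsRealContinuousOn u Eᶜ

/-- The characteristic function of `A`. -/
def chi (A : Set P) : P → EReal :=
  A.indicator (fun _ => 1)

/-- Every ball has positive and finite measure. -/
def BallsPosFinite (μ : Measure P) : Prop :=
  ∀ (x : P) (r : ℝ), 0 < r → 0 < μ (Metric.ball x r) ∧ μ (Metric.ball x r) < ∞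

end Newtonian

/-! ### The von Koch curve and the von Koch snowflake -/

/-- The rotations in the four similarities of the von Koch curve. -/
def kochRot : Fin 4 → ℂ :=
  ![1, Complex.exp ((Real.pi / 3 : ℝ) * Complex.I),
    Complex.exp ((-(Real.pi / 3) : ℝ) * Complex.I), 1]

/-- The images of `0` under the four similarities of the von Koch curve. -/
def kochShift : Fin 4 → ℂ :=
  ![0, 1 / 3, 1 / 2 + (Real.sqrt 3 / 6 : ℝ) * Complex.I, 2 / 3]

/-- The four similarities of ratio `1/3` which map the segment `[0,1]` onto the four sides of the
polygon `0, 1/3, 1/2 + (√3/6) i, 2/3, 1`, in this order and with this orientation. -/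
def kochMap (i : Fin 4) (z : ℂ) : ℂ :=
  kochShift i + kochRot i * z / 3

theorem norm_kochRot (i : Fin 4) : ‖kochRot i‖ = 1 := by
  fin_cases i
  · simp [kochRot]
  · exact Complex.norm_exp_ofReal_mul_I _
  · exact Complex.norm_exp_ofReal_mul_I _
  · simp [kochRot]

theorem dist_kochMap (i : Fin 4) (z w : ℂ) : dist (kochMap i z) (kochMap i w) = dist z w / 3 := by
  have h : kochMap i z - kochMap i w = kochRot i * (z - w) / 3 := by
    unfold kochMap; ring
  rw [dist_eq_norm, dist_eq_norm, h, norm_div, norm_mul, norm_kochRot]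
  simp

theorem lipschitz_kochMap (i : Fin 4) : LipschitzWith (1 / 3) (kochMap i) :=
  LipschitzWith.of_dist_le_mul fun z w => by
    rw [dist_kochMap]; push_cast; linarith

/-- The operator `A ↦ f₀(A) ∪ f₁(A) ∪ f₂(A) ∪ f₃(A)` on the nonempty compact subsets of the
plane. -/
def kochStep (A : NonemptyCompacts ℂ) : NonemptyCompacts ℂ where
  carrier := ⋃ i, kochMap i '' A
  isCompact' := isCompact_iUnion fun i => A.isCompact.image (lipschitz_kochMap i).continuous
  nonempty' := by
    obtain ⟨z, hz⟩ := A.nonempty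
    exact ⟨kochMap 0 z, mem_iUnion.2 ⟨0, mem_image_of_mem _ hz⟩⟩

theorem coe_kochStep (A : NonemptyCompacts ℂ) :
    (kochStep A : Set ℂ) = ⋃ i, kochMap i '' A := rfl

/-- `kochStep` is a contraction for the Hausdorff distance. -/
theorem contracting_kochStep : ContractingWith (1 / 3) kochStep := by
  refine ⟨by rw [← NNReal.coe_lt_coe]; norm_num, fun A B => ?_⟩
  change Metric.hausdorffEDist (⋃ i, kochMap i '' (A : Set ℂ)) (⋃ i, kochMap i '' (B : Set ℂ)) ≤
    ((1 / 3 : ℝ≥0) : ℝ≥0∞) * Metric.hausdorffEDist (A : Set ℂ) (B : Set ℂ)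
  refine Metric.hausdorffEDist_iUnion_le.trans (iSup_le fun i => ?_)
  have key : ∀ S T : NonemptyCompacts ℂ, ∀ x ∈ kochMap i '' (S : Set ℂ),
      Metric.infEDist x (kochMap i '' (T : Set ℂ)) ≤
        ((1 / 3 : ℝ≥0) : ℝ≥0∞) * Metric.hausdorffEDist (S : Set ℂ) (T : Set ℂ) := by
    rintro S T _ ⟨z, hz, rfl⟩
    obtain ⟨w, hw, hzw⟩ := T.isCompact.exists_infEDist_eq_edist T.nonempty z
    calc Metric.infEDist (kochMap i z) (kochMap i '' (T : Set ℂ))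
        ≤ edist (kochMap i z) (kochMap i w) :=
          Metric.infEDist_le_edist_of_mem (mem_image_of_mem _ hw)
      _ ≤ ((1 / 3 : ℝ≥0) : ℝ≥0∞) * edist z w := lipschitz_kochMap i z w
      _ ≤ _ := by
          rw [← hzw]
          gcongr
          exact Metric.infEDist_le_hausdorffEDist_of_mem hz
  refine Metric.hausdorffEDist_le_of_infEDist (key A B) ?_
  rw [Metric.hausdorffEDist_comm]
  exact key B A

/-- The von Koch curve over the segment `[0,1]`: the unique nonempty compact set `K` of the plane
with `K = f₀(K) ∪ f₁(K) ∪ f₂(K) ∪ f₃(K)`, which is the limit, in the Hausdorff distance, of the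
polygons obtained from the segment `[0,1]` by repeatedly replacing the middle third of
every side by the two other sides of an equilateral triangle. -/
def kochCompact : NonemptyCompacts ℂ :=
  haveI : Nonempty (NonemptyCompacts ℂ) := ⟨{0}⟩
  contracting_kochStep.fixedPoint kochStep

/-- The von Koch curve as a set. -/
def kochCurve : Set ℂ := kochCompact

theorem kochCurve_nonempty : kochCurve.Nonempty := kochCompact.nonempty

theorem kochCurve_isCompact : IsCompact kochCurve := kochCompact.isCompact

theorem kochCurve_eq : kochCurve = ⋃ i, kochMap i '' kochCurve := by
  have : Nonempty (NonemptyCompacts ℂ) := ⟨{0}⟩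
  have h : kochStep kochCompact = kochCompact := contracting_kochStep.fixedPoint_isFixedPt
  exact (congrArg (fun A : NonemptyCompacts ℂ => (A : Set ℂ)) h).symm

/-- The third vertex of the equilateral triangle with side `[0,1]` that lies below this side. -/
def triVertex : ℂ := Complex.exp ((-(Real.pi / 3) : ℝ) * Complex.I)

/-- The closed von Koch snowflake curve: the union of the three congruent copies of the von Koch
curve over the sides `0 → 1 → triVertex → 0` of an equilateral triangle, all of them turned
outwards. -/
def kochSnowflake : Set ℂ :=
  kochCurve ∪ (fun z => 1 + (triVertex - 1) * z) '' kochCurve ∪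
    (fun z => triVertex - triVertex * z) '' kochCurve

/-- The `log 4 / log 3`-dimensional Hausdorff measure on a set `K` in the plane, as a metric space
in its own right. -/
def kochMeasure (K : Set ℂ) : Measure K :=
  Measure.hausdorffMeasure (Real.log 4 / Real.log 3)

end NewtonLInfty

end

open NewtonLInfty

/-! Let `ρ` be essentially bounded with infinite integral along every curve. Keeping `ρ` only on the
null set where it exceeds its essential supremum preserves these infinite integrals, because the
discarded part contributes at most a constant times the length. The result is an upper gradient of
every function and has norm 0, so the Newtonian norm is the sup norm
(`AlmostNoRectCurves.exists_upperGradient`). Consequently null sets have capacity 0, sets of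
capacity less than 1 are null, and a nonempty open set has capacity at least 1 since it contains a
ball. The only open set of small capacity is thus empty, which gives (a) and (b). In (c), an
exceptional set is null and cannot hide the nonempty open sets `ball \ F`.

For the von Koch curve put `s = log 4 / log 3 > 1`. The curve is a snowflake arc: it has a
coordinate onto `[0,1]` whose increments are comparable to the `s`-th power of the distance
(`isSnowflakeArc_kochCurve`). Along a unit speed curve this coordinate is Hölder with exponent `s >
1`, hence constant, so there are no such curves at all. Both Hölder bounds compare `s`-dimensional
measure with length, so balls have positive finite measure. The coordinate is read off from base 4
itineraries. It is estimated by `le_of_descent`, which strips common leading digits until two points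
lie in different pieces. The closed snowflake is a union of three isometric copies. -/

namespace NewtonLInfty

/-! ### Unit speed curves, curve integrals and continuity of characteristic functions. -/

section Curves

variable {P : Type*} [MetricSpace P]

theorem HasUnitSpeedOn.edist_le {f : ℝ → P} {s : Set ℝ} (h : HasUnitSpeedOn f s) {x y : ℝ}
    (hx : x ∈ s) (hy : y ∈ s) : edist (f x) (f y) ≤ edist x y := by
  wlog hxy : x ≤ y generalizing x y
  · rw [edist_comm, edist_comm x]
    exact this hy hx (le_of_not_ge hxy)
  refine (eVariationOn.edist_le f (s := s ∩ Icc x y)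
    ⟨hx, le_rfl, hxy⟩ ⟨hy, hxy, le_rfl⟩).trans_eq ?_
  rw [h hx hy, edist_comm, edist_dist, Real.dist_eq, abs_of_nonneg (by linarith)]
  simp

theorem HasUnitSpeedOn.continuousOn {f : ℝ → P} {s : Set ℝ} (h : HasUnitSpeedOn f s) :
    ContinuousOn f s := by
  have hl : LipschitzOnWith 1 f s := fun x hx y hy => by simpa using h.edist_le hx hy
  exact hl.continuousOn

theorem IsBorelFun.indicator_le {ρ : P → ℝ≥0∞} (hρ : IsBorelFun ρ) (M : ℝ≥0∞) :
    IsBorelFun ({x | ρ x ≤ M}.indicator ρ) := by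
  let _ : MeasurableSpace P := borel P
  have hρ' : Measurable ρ := hρ
  exact hρ'.indicator (measurableSet_le hρ' measurable_const)

theorem IsBorelFun.indicator_compl_le {ρ : P → ℝ≥0∞} (hρ : IsBorelFun ρ) (M : ℝ≥0∞) :
    IsBorelFun ({x | ρ x ≤ M}ᶜ.indicator ρ) := by
  let _ : MeasurableSpace P := borel P
  have hρ' : Measurable ρ := hρ
  exact hρ'.indicator (measurableSet_le hρ' measurable_const).compl

theorem RectCurve.integral_add (γ : RectCurve P) {ρ : P → ℝ≥0∞} (hρ : IsBorelFun ρ)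
    (σ : P → ℝ≥0∞) : γ.integral (ρ + σ) = γ.integral ρ + γ.integral σ := by
  let _ : MeasurableSpace P := borel P
  have _ : BorelSpace P := ⟨rfl⟩
  have hρ' : Measurable ρ := hρ
  exact lintegral_add_left'
    (hρ'.comp_aemeasurable (γ.unitSpeed.continuousOn.aemeasurable measurableSet_Icc)) _

theorem RectCurve.integral_indicator_le (γ : RectCurve P) (ρ : P → ℝ≥0∞) (M : ℝ≥0∞) :
    γ.integral ({x | ρ x ≤ M}.indicator ρ) ≤ M * ENNReal.ofReal γ.length := by
  refine (lintegral_mono (g := fun _ => M) fun t => ?_).trans (by simp)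
  exact indicator_apply_le' (fun h => h) fun _ => zero_le

/-- Since `chi F x = 1 > 0`, relative continuity keeps `chi F` positive near `x` off `E`. -/
theorem exists_ball_diff_subset {F E : Set P} {x : P} (hF : x ∈ F) (hE : x ∉ E)
    (hc : IsRealContinuousOn (chi F) Eᶜ) : ∃ r > 0, Metric.ball x r \ E ⊆ F := by
  have hpos : ∀ᶠ y in nhdsWithin x Eᶜ, 0 < chi F y :=
    (hc.1 x hE).eventually (lt_mem_nhds (by simp [chi, hF]))
  obtain ⟨r, hr, hsub⟩ := Metric.mem_nhdsWithin_iff.1 hpos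
  refine ⟨r, hr, fun y hy => ?_⟩
  by_contra hyF
  have : 0 < chi F y := hsub hy
  simp [chi, hyF] at this

theorem isRealContinuousOn_chi_compl (A : Set P) : IsRealContinuousOn (chi A) Aᶜ := by
  refine ⟨continuousOn_const.congr (f := fun _ => (0 : EReal)) fun x hx => ?_, fun x hx => ?_⟩
  · exact indicator_of_notMem hx _
  · rw [chi, indicator_of_notMem hx]
    simp

end Curves

/-! ### Capacity and quasicontinuity in spaces with almost no rectifiable curves. -/

section General

theorem abs_chi {P : Type*} (A : Set P) (x : P) :
    (chi A x).abs = A.indicator (fun _ => 1) x := by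
  by_cases hx : x ∈ A
  · simp only [chi, indicator_of_mem hx]
    rw [← EReal.coe_one, EReal.abs_def]
    simp
  · simp [chi, hx]

theorem chi_mem_LInfty {P : Type*} [MeasurableSpace P] {μ : Measure P} {A : Set P}
    (hA : NullMeasurableSet A μ) : chi A ∈ LInfty μ := by
  classical
  refine ⟨?_, ?_⟩
  · intro s _
    rw [chi, indicator_const_preimage_eq_union]
    refine NullMeasurableSet.union ?_ ?_
    · split_ifs
      exacts [hA, MeasurableSet.empty.nullMeasurableSet]
    · split_ifs
      exacts [hA.compl, MeasurableSet.empty.nullMeasurableSet]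
  · refine (essSup_le_of_ae_le 1 (.of_forall fun x => ?_)).trans_lt ENNReal.one_lt_top
    rw [abs_chi]
    exact indicator_apply_le' (fun _ => le_rfl) fun _ => zero_le

variable {P : Type*} [MetricSpace P] [MeasurableSpace P] {μ : Measure P}

/-- Where almost no curve is rectifiable, some upper gradient of every function vanishes almost
everywhere. -/
theorem AlmostNoRectCurves.exists_upperGradient [OpensMeasurableSpace P]
    (h : AlmostNoRectCurves μ) :
    ∃ g : P → ℝ≥0∞, essSup g μ = 0 ∧ ∀ u : P → EReal, IsUpperGradient g u := by
  obtain ⟨ρ, hρ, hfin, hint⟩ := h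
  -- The set where `ρ` exceeds its essential supremum is null. On the rest `ρ` is bounded, so it has
  -- finite integral along each curve and the infinite part must come from this indicator.
  refine ⟨{x | ρ x ≤ essSup ρ μ}ᶜ.indicator ρ, ?_,
    fun u => ⟨hρ.indicator_compl_le _, fun γ => ?_⟩⟩
  · rw [ENNReal.essSup_eq_zero_iff]
    filter_upwards [ENNReal.ae_le_essSup ρ] with x hx
    exact indicator_of_notMem (by simpa using hx) _
  · suffices hγ : γ.integral ({x | ρ x ≤ essSup ρ μ}ᶜ.indicator ρ) = ∞ by simp [hγ]
    by_contra hne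
    have hsum := γ.integral_add (hρ.indicator_le (essSup ρ μ))
      ({x | ρ x ≤ essSup ρ μ}ᶜ.indicator ρ)
    rw [indicator_self_add_compl, hint γ (mem_univ _)] at hsum
    have hlt := (γ.integral_indicator_le ρ (essSup ρ μ)).trans_lt
      (ENNReal.mul_lt_top hfin ENNReal.ofReal_lt_top)
    exact ENNReal.add_ne_top.2 ⟨hlt.ne, hne⟩ hsum.symm

theorem AlmostNoRectCurves.newtonNorm_eq [OpensMeasurableSpace P] (h : AlmostNoRectCurves μ)
    (u : P → EReal) : newtonNorm μ u = supNorm μ u := by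
  obtain ⟨g, hg, hu⟩ := h.exists_upperGradient
  unfold newtonNorm
  rw [le_antisymm ((iInf₂_le g (hu u)).trans_eq hg) zero_le, add_zero]

theorem AlmostNoRectCurves.n1Infty_eq [OpensMeasurableSpace P] (h : AlmostNoRectCurves μ) :
    N1Infty μ = LInfty μ := by
  ext u
  refine ⟨fun hu => hu.1, fun hu => ⟨hu, ?_⟩⟩
  rw [h.newtonNorm_eq]
  exact hu.2

theorem one_le_abs_of_one_le {a : EReal} (h : 1 ≤ a) : 1 ≤ a.abs := by
  induction a with
  | bot => simp
  | top => simp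
  | coe a =>
    rw [EReal.abs_def]
    have : (1 : ℝ) ≤ a := by exact_mod_cast h
    rw [← ENNReal.ofReal_one]
    exact ENNReal.ofReal_le_ofReal (this.trans (le_abs_self a))

/-- An admissible `u` of norm less than 1 satisfies `|u| < 1` almost everywhere, but `|u| ≥ 1` on
`E`. As `μ` acts as an outer measure, `E` need not be measurable. -/
theorem measure_eq_zero_of_capacity_lt_one {E : Set P} (h : capacity μ E < 1) : μ E = 0 := by
  simp only [capacity, iInf_lt_iff] at h
  obtain ⟨u, ⟨-, hu⟩, hlt⟩ := h
  have hae : ∀ᵐ x ∂μ, (u x).abs < 1 :=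
    ae_lt_of_essSup_lt ((le_self_add : supNorm μ u ≤ newtonNorm μ u).trans_lt hlt)
  exact measure_mono_null (fun x hx => not_lt.2 (one_le_abs_of_one_le (hu x hx))) hae

theorem AlmostNoRectCurves.capacity_eq_zero [OpensMeasurableSpace P] (h : AlmostNoRectCurves μ)
    {E : Set P} (hE : μ E = 0) : capacity μ E = 0 := by
  have hmem : chi E ∈ N1Infty μ := by
    rw [h.n1Infty_eq]
    exact chi_mem_LInfty (NullMeasurableSet.of_null hE)
  refine le_antisymm ((iInf₂_le (chi E) ⟨hmem, fun x hx => by simp [chi, hx]⟩).trans_eq ?_) zero_le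
  rw [h.newtonNorm_eq, supNorm, ENNReal.essSup_eq_zero_iff]
  filter_upwards [measure_eq_zero_iff_ae_notMem.1 hE] with x hx
  simp [abs_chi, hx]

theorem BallsPosFinite.measure_pos (hμ : BallsPosFinite μ) {U : Set P} (hU : IsOpen U)
    (hne : U.Nonempty) : 0 < μ U := by
  obtain ⟨x, hx⟩ := hne
  obtain ⟨r, hr, hsub⟩ := Metric.isOpen_iff.1 hU x hx
  exact (hμ x r hr).1.trans_le (measure_mono hsub)

theorem BallsPosFinite.one_le_capacity (hμ : BallsPosFinite μ) {U : Set P} (hU : IsOpen U)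
    (hne : U.Nonempty) : 1 ≤ capacity μ U :=
  not_lt.1 fun h => (hμ.measure_pos hU hne).ne' (measure_eq_zero_of_capacity_lt_one h)

/-- The conclusions for spaces with almost no rectifiable curves. -/
theorem newtonLInfty_of_almostNoRectCurves [OpensMeasurableSpace P] {x₀ : P}
    (hμ : BallsPosFinite μ) (hno : AlmostNoRectCurves μ) (hx₀ : μ {x₀} = 0) :
    N1Infty μ = LInfty μ ∧ (∀ u ∈ LInfty μ, newtonNorm μ u = supNorm μ u) ∧
      (chi {x₀} ∈ N1Infty μ ∧ WeaklyQuasicontinuous μ (chi {x₀}) ∧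
        ¬ Quasicontinuous μ (chi {x₀})) ∧
      (¬ IsOuterCapacity μ ∧ ¬ IsOuterForZeroSets μ) ∧
      (∀ F : Set P, IsClosed F → interior F = ∅ → 0 < μ F →
        chi F ∈ N1Infty μ ∧ ¬ WeaklyQuasicontinuous μ (chi F)) := by
  have hcap : capacity μ {x₀} = 0 := hno.capacity_eq_zero hx₀
  refine ⟨hno.n1Infty_eq, fun u _ => hno.newtonNorm_eq u, ⟨?_, ?_, ?_⟩, ⟨?_, ?_⟩, ?_⟩
  · rw [hno.n1Infty_eq]
    exact chi_mem_LInfty (NullMeasurableSet.of_null hx₀)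
  · exact fun ε hε => ⟨{x₀}, hcap.trans_lt hε, isRealContinuousOn_chi_compl _⟩
  · intro hq
    obtain ⟨E, hE, hlt, hc⟩ := hq 1 one_pos
    -- Openness leaves no exceptional set, so `chi {x₀}` would be continuous everywhere and a whole
    -- ball would lie in the null set `{x₀}`.
    obtain rfl : E = ∅ := by
      by_contra hne
      exact not_lt.2 (hμ.one_le_capacity hE (nonempty_iff_ne_empty.2 hne)) hlt
    obtain ⟨r, hr, hsub⟩ := exists_ball_diff_subset (mem_singleton x₀) (notMem_empty x₀) hc
    rw [sdiff_empty] at hsub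
    exact (hμ x₀ r hr).1.ne' (measure_mono_null hsub hx₀)
  · intro h
    have h1 : (1 : ℝ≥0∞) ≤ ⨅ (G : Set P) (_ : IsOpen G ∧ {x₀} ⊆ G), capacity μ G :=
      le_iInf₂ fun G hG => hμ.one_le_capacity hG.1 ⟨x₀, hG.2 rfl⟩
    have h2 := h1.trans ((h {x₀}).trans_eq hcap)
    simp at h2
  · intro h
    obtain ⟨G, hG, hsub, hlt⟩ := h {x₀} hcap 1 one_pos
    exact not_lt.2 (hμ.one_le_capacity hG ⟨x₀, hsub rfl⟩) hlt
  · intro F hF hint hpos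
    refine ⟨?_, fun hw => ?_⟩
    · rw [hno.n1Infty_eq]
      exact chi_mem_LInfty hF.measurableSet.nullMeasurableSet
    obtain ⟨E, hlt, hc⟩ := hw 1 one_pos
    have hE := measure_eq_zero_of_capacity_lt_one hlt
    obtain ⟨x, hxF, hxE⟩ : ∃ x ∈ F, x ∉ E := by
      by_contra! hsub
      exact hpos.ne' (measure_mono_null hsub hE)
    obtain ⟨r, hr, hsub⟩ := exists_ball_diff_subset hxF hxE hc
    -- This set is open, hence of positive measure, yet continuity off `E` forces it into the null
    -- set `E`.
    have hne : (Metric.ball x r \ F).Nonempty := by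
      rw [sdiff_nonempty]
      intro hb
      have := interior_maximal hb Metric.isOpen_ball (Metric.mem_ball_self hr)
      simp [hint] at this
    refine (hμ.measure_pos (Metric.isOpen_ball.sdiff hF) hne).ne' (measure_mono_null ?_ hE)
    exact fun y hy => by_contra fun hyE => hy.2 (hsub ⟨hy.1, hyE⟩)

end General

/-! ### Snowflake arcs: absence of rectifiable curves and Hausdorff measure. -/

section Arcs

variable {X Y : Type*} [MetricSpace X] [MetricSpace Y]

/-- `S` contains no nonconstant curve parametrized by arc length. -/
def NoUnitSpeedCurves (S : Set X) : Prop :=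
  ∀ (γ : ℝ → X) (a b : ℝ), a < b → HasUnitSpeedOn γ (Icc a b) → ¬ MapsTo γ (Icc a b) S

theorem HasUnitSpeedOn.mono_Icc {γ : ℝ → X} {a b c d : ℝ} (h : HasUnitSpeedOn γ (Icc a b))
    (hac : a ≤ c) (hdb : d ≤ b) : HasUnitSpeedOn γ (Icc c d) := by
  intro x hx y hy
  have hxy : Icc x y ⊆ Icc c d := Icc_subset_Icc hx.1 hy.2
  have hcd : Icc c d ⊆ Icc a b := Icc_subset_Icc hac hdb
  rw [inter_eq_right.2 hxy, ← h (hcd hx) (hcd hy), inter_eq_right.2 (hxy.trans hcd)]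

theorem HasUnitSpeedOn.exists_ne {γ : ℝ → X} {a b : ℝ} (hab : a < b)
    (h : HasUnitSpeedOn γ (Icc a b)) : ∃ x ∈ Icc a b, ∃ y ∈ Icc a b, γ x ≠ γ y := by
  by_contra! hc
  have h1 := h (left_mem_Icc.2 hab.le) (right_mem_Icc.2 hab.le)
  rw [inter_self, eVariationOn.constant_on fun x hx y hy => ?_] at h1
  · have : ENNReal.ofReal ((1 : ℝ≥0) * (b - a)) = 0 := h1.symm
    rw [ENNReal.ofReal_eq_zero, NNReal.coe_one] at this
    linarith
  · obtain ⟨x, hx, rfl⟩ := hx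
    obtain ⟨y, hy, rfl⟩ := hy
    exact hc x hx y hy

/-- A curve in the union must leave `A` at some time. As `A` is closed, it stays outside `A`, and
therefore in `B`, during a nondegenerate time interval. -/
theorem NoUnitSpeedCurves.union {A B : Set X} (hA : NoUnitSpeedCurves A)
    (hB : NoUnitSpeedCurves B) (hcl : IsClosed A) : NoUnitSpeedCurves (A ∪ B) := by
  intro γ a b hab hγ hmaps
  have hnot := hA γ a b hab hγ
  simp only [MapsTo, not_forall] at hnot
  obtain ⟨t, ht, htA⟩ := hnot
  obtain ⟨ε, hε, hsub⟩ := Metric.mem_nhdsWithin_iff.1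
    (hγ.continuousOn t ht (hcl.isOpen_compl.mem_nhds htA))
  -- The exit time `t` may be an endpoint of `[a, b]`, hence the truncation.
  have hac : a ≤ max a (t - ε / 2) := le_max_left _ _
  have hdb : min b (t + ε / 2) ≤ b := min_le_left _ _
  refine hB γ (max a (t - ε / 2)) (min b (t + ε / 2)) ?_ (hγ.mono_Icc hac hdb) fun x hx => ?_
  · rcases eq_or_lt_of_le ht.1 with rfl | h1
    · exact max_lt (lt_min hab (by linarith)) (lt_min (by linarith) (by linarith))
    · exact max_lt (lt_min hab (by linarith [ht.1])) (lt_min (by linarith [ht.2]) (by linarith))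
  · have hx' : x ∈ Icc a b := ⟨hac.trans hx.1, hx.2.trans hdb⟩
    refine (hmaps hx').resolve_left (hsub ⟨?_, hx'⟩)
    have h1 := (le_max_right _ _).trans hx.1
    have h2 := hx.2.trans (min_le_right _ _)
    rw [Metric.mem_ball, Real.dist_eq, abs_lt]
    constructor <;> linarith

theorem holderOnWith_of_dist_le {C r : ℝ≥0} {f : X → Y} {S : Set X}
    (h : ∀ x ∈ S, ∀ y ∈ S, dist (f x) (f y) ≤ C * dist x y ^ (r : ℝ)) :
    HolderOnWith C r f S := by
  intro x hx y hy
  rw [edist_dist, edist_dist, ENNReal.ofReal_rpow_of_nonneg dist_nonneg r.coe_nonneg,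
    ← ENNReal.ofReal_coe_nnreal, ← ENNReal.ofReal_mul C.coe_nonneg]
  exact ENNReal.ofReal_le_ofReal (h x hx y hy)

/-- A function that is Hölder continuous with an exponent larger than one is constant. -/
theorem HolderOnWith.eq_of_one_lt {C r : ℝ≥0} (hr : 1 < r) {f : ℝ → ℝ} {a b : ℝ}
    (hf : HolderOnWith C r f (Icc a b)) {x y : ℝ} (hx : x ∈ Icc a b) (hy : y ∈ Icc a b) :
    f x = f y := by
  have hsub : uIcc x y ⊆ Icc a b := ordConnected_Icc.uIcc_subset hx hy
  have hr0 : 0 < r := zero_lt_one.trans hr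
  have hivt := intermediate_value_uIcc ((hf.mono hsub).continuousOn hr0)
  -- Finite length makes the `r`-dimensional measure vanish for `r > 1`. The Hölder image then has
  -- length zero, although it contains the interval between `f x` and `f y`.
  have hzero : μH[(r : ℝ)] (Icc a b) = 0 := by
    refine (Measure.hausdorffMeasure_zero_or_top (d₁ := 1) (d₂ := r) (by exact_mod_cast hr)
      (Icc a b)).resolve_right ?_
    rw [hausdorffMeasure_real]
    exact measure_Icc_lt_top.ne
  have him : μH[1] (f '' Icc a b) = 0 := by
    refine le_antisymm ((hf.hausdorffMeasure_image_le hr0 zero_le_one).trans_eq ?_) zero_le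
    rw [mul_one, hzero, mul_zero]
  rw [hausdorffMeasure_real] at him
  have hvol := measure_mono_null (hivt.trans (image_mono hsub)) him
  rw [Real.volume_interval, ENNReal.ofReal_eq_zero] at hvol
  exact (sub_eq_zero.1 (abs_eq_zero.1 (le_antisymm hvol (abs_nonneg _)))).symm

/-- `S` is an arc of snowflake type with exponent `s`: it can be identified with `[0, 1]` in such
a way that the distance in `[0, 1]` is comparable to the `s`-th power of the distance in `S`. -/
def IsSnowflakeArc (s : ℝ) (S : Set X) : Prop :=
  ∃ (g : X → ℝ) (C : ℝ≥0), 0 < C ∧ g '' S = Icc 0 1 ∧ ∀ x ∈ S, ∀ y ∈ S,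
    dist x y ^ s ≤ C * |g x - g y| ∧ |g x - g y| ≤ C * dist x y ^ s

theorem IsSnowflakeArc.image {s : ℝ} {S : Set X} (hS : IsSnowflakeArc s S) {f : X → Y}
    (hf : Isometry f) : IsSnowflakeArc s (f '' S) := by
  obtain ⟨g, C, hC, hg, h⟩ := hS
  refine ⟨Function.extend f g 0, C, hC, ?_, ?_⟩
  · rw [image_image]
    simpa only [hf.injective.extend_apply] using hg
  · rintro _ ⟨x, hx, rfl⟩ _ ⟨y, hy, rfl⟩
    simpa only [hf.injective.extend_apply, hf.dist_eq] using h x hx y hy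

/-- The coordinate of a 1-Lipschitz curve is Hölder with exponent `s > 1`, hence constant. The
coordinate is injective on `S`, so the curve would be constant too. -/
theorem IsSnowflakeArc.noUnitSpeedCurves {s : ℝ} (hs : 1 < s) {S : Set X}
    (hS : IsSnowflakeArc s S) : NoUnitSpeedCurves S := by
  intro γ a b hab hγ hmaps
  obtain ⟨g, C, hC, hg, h⟩ := hS
  lift s to ℝ≥0 using by linarith
  have hh : HolderOnWith C s (g ∘ γ) (Icc a b) := by
    refine holderOnWith_of_dist_le fun x hx y hy => ?_
    refine (h _ (hmaps hx) _ (hmaps hy)).2.trans ?_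
    gcongr
    have := hγ.edist_le hx hy
    rwa [edist_dist, edist_dist, ENNReal.ofReal_le_ofReal_iff dist_nonneg] at this
  obtain ⟨x, hx, y, hy, hne⟩ := hγ.exists_ne hab
  have heq := HolderOnWith.eq_of_one_lt (by exact_mod_cast hs) hh hx hy
  have hd := (h _ (hmaps hx) _ (hmaps hy)).1
  rw [show g (γ x) = g (γ y) from heq, sub_self, abs_zero, mul_zero] at hd
  exact (Real.rpow_pos_of_pos (dist_pos.2 hne) _).not_ge hd

/-- The inverse of the coordinate on an arc of snowflake type is Hölder continuous. -/
theorem IsSnowflakeArc.exists_param {s : ℝ≥0} (hs : 0 < s) {S : Set X}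
    (hS : IsSnowflakeArc s S) :
    ∃ (h : ℝ → X) (C : ℝ≥0), HolderOnWith C s⁻¹ h (Icc 0 1) ∧ h '' Icc 0 1 = S := by
  obtain ⟨g, C, hC, hg, h⟩ := hS
  have hex : ∀ t : ℝ, ∃ x, t ∈ Icc (0 : ℝ) 1 → x ∈ S ∧ g x = t := by
    intro t
    by_cases ht : t ∈ Icc (0 : ℝ) 1
    · obtain ⟨x, hx, hxt⟩ := hg.symm ▸ ht
      exact ⟨x, fun _ => ⟨hx, hxt⟩⟩
    · obtain ⟨x, -, -⟩ := hg.symm ▸ (left_mem_Icc.2 zero_le_one : (0 : ℝ) ∈ Icc 0 1)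
      exact ⟨x, fun h => absurd h ht⟩
  choose k hk using hex
  refine ⟨k, C ^ (s⁻¹ : ℝ), holderOnWith_of_dist_le fun t ht u hu => ?_, ?_⟩
  · have hd := (h _ (hk t ht).1 _ (hk u hu).1).1
    rw [(hk t ht).2, (hk u hu).2, ← Real.dist_eq] at hd
    have hs' : (0 : ℝ) < s := hs
    rw [NNReal.coe_rpow, NNReal.coe_inv, ← Real.mul_rpow C.coe_nonneg dist_nonneg,
      Real.le_rpow_inv_iff_of_pos dist_nonneg (by positivity) hs']
    exact hd
  · refine Subset.antisymm (image_subset_iff.2 fun t ht => (hk t ht).1) fun x hx => ?_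
    have hgx : g x ∈ Icc (0 : ℝ) 1 := hg ▸ mem_image_of_mem g hx
    refine ⟨g x, hgx, by_contra fun hne => ?_⟩
    have hd := (h _ (hk _ hgx).1 _ hx).1
    rw [(hk _ hgx).2, sub_self, abs_zero, mul_zero] at hd
    exact (Real.rpow_pos_of_pos (dist_pos.2 hne) _).not_ge hd

theorem NoUnitSpeedCurves.almostNoRectCurves {S : Set X} (hS : NoUnitSpeedCurves S)
    [MeasurableSpace S] (μ : Measure S) : AlmostNoRectCurves μ := by
  refine ⟨0, @measurable_const _ _ _ (borel S) 0, ?_, fun γ _ => ?_⟩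
  · exact (essSup_le_of_ae_le 0 (.of_forall fun _ => le_rfl)).trans_lt ENNReal.zero_lt_top
  · have hγ : HasUnitSpeedOn (fun t => (γ.toFun t : X)) (Icc 0 γ.length) := γ.unitSpeed
    exact absurd (fun t _ => (γ.toFun t).2) (hS _ _ _ γ.length_pos hγ)

variable [MeasurableSpace X] [BorelSpace X]

/-- A compact set of finite `s`-dimensional measure, all portions of which have positive measure,
without rectifiable curves. -/
structure IsFractal (s : ℝ) (S : Set X) : Prop where
  isCompact : IsCompact S
  measure_lt_top : μH[s] S < ∞
  measure_pos : ∀ x ∈ S, ∀ r > 0, 0 < μH[s] (S ∩ Metric.ball x r)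
  noCurves : NoUnitSpeedCurves S

theorem IsFractal.union {s : ℝ} {A B : Set X} (hA : IsFractal s A) (hB : IsFractal s B) :
    IsFractal s (A ∪ B) where
  isCompact := hA.isCompact.union hB.isCompact
  measure_lt_top := measure_union_lt_top hA.measure_lt_top hB.measure_lt_top
  measure_pos := by
    rintro x (hx | hx) r hr
    · exact (hA.measure_pos x hx r hr).trans_le
        (measure_mono (inter_subset_inter_left _ subset_union_left))
    · exact (hB.measure_pos x hx r hr).trans_le
        (measure_mono (inter_subset_inter_left _ subset_union_right))
  noCurves := hA.noCurves.union hB.noCurves hA.isCompact.isClosed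

/-- The coordinate maps this portion onto a set containing an interval, and its Hölder bound
dominates length by a multiple of the `s`-dimensional measure. -/
theorem IsSnowflakeArc.measure_inter_ball_pos {s : ℝ≥0} (hs : 0 < s) {S : Set X}
    (hS : IsSnowflakeArc s S) {x : X} (hx : x ∈ S) {r : ℝ} (hr : 0 < r) :
    0 < μH[(s : ℝ)] (S ∩ Metric.ball x r) := by
  obtain ⟨g, C, hC, hg, h⟩ := hS
  have hC' : (0 : ℝ) < C := hC
  have hs' : (0 : ℝ) < s := hs
  obtain ⟨δ, hδ, hδr⟩ : ∃ δ > 0, C * δ ≤ r ^ (s : ℝ) :=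
    ⟨r ^ (s : ℝ) / C, by positivity, by field_simp; rfl⟩
  have hsub : Ioo (max 0 (g x - δ)) (min 1 (g x + δ)) ⊆ g '' (S ∩ Metric.ball x r) := by
    rintro t ⟨h1, h2⟩
    rw [max_lt_iff] at h1
    rw [lt_min_iff] at h2
    have ht : t ∈ g '' S := hg.symm ▸ ⟨h1.1.le, h2.1.le⟩
    obtain ⟨y, hy, rfl⟩ := ht
    refine ⟨y, ⟨hy, ?_⟩, rfl⟩
    have habs : |g y - g x| < δ := abs_lt.2 ⟨by linarith, by linarith⟩
    have hlt : dist y x ^ (s : ℝ) < r ^ (s : ℝ) :=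
      (h y hy x hx).1.trans_lt ((mul_lt_mul_of_pos_left habs hC').trans_le hδr)
    exact (Real.rpow_lt_rpow_iff dist_nonneg hr.le hs').1 hlt
  have hgx : g x ∈ Icc (0 : ℝ) 1 := hg ▸ mem_image_of_mem g hx
  have hvol : 0 < volume (Ioo (max 0 (g x - δ)) (min 1 (g x + δ))) := by
    rw [Real.volume_Ioo, ENNReal.ofReal_pos, sub_pos]
    exact max_lt (lt_min one_pos (by linarith [hgx.1]))
      (lt_min (by linarith [hgx.2]) (by linarith))
  have hh : HolderOnWith C s g (S ∩ Metric.ball x r) :=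
    holderOnWith_of_dist_le fun y hy z hz => (h y hy.1 z hz.1).2
  have hle := (measure_mono hsub).trans_eq (congrFun (congrArg _ hausdorffMeasure_real.symm) _)
  have hle' := hle.trans (hh.hausdorffMeasure_image_le hs zero_le_one)
  rw [mul_one] at hle'
  exact (ENNReal.mul_pos_iff.1 (hvol.trans_le hle')).2

/-- Compactness and finite measure come from the `s⁻¹`-Hölder parametrization by `[0,1]`, since `s⁻¹
* s = 1` turns the measure bound into one by length. -/
theorem IsSnowflakeArc.isFractal {s : ℝ} (hs : 1 < s) {S : Set X} (hS : IsSnowflakeArc s S) :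
    IsFractal s S := by
  have hno := hS.noUnitSpeedCurves hs
  lift s to ℝ≥0 using by linarith
  have hs0 : 0 < s := zero_lt_one.trans (by exact_mod_cast hs)
  obtain ⟨h, C, hh, him⟩ := hS.exists_param hs0
  refine ⟨?_, ?_, fun x hx r hr => hS.measure_inter_ball_pos hs0 hx hr, hno⟩
  · rw [← him]
    exact isCompact_Icc.image_of_continuousOn (hh.continuousOn (inv_pos.2 hs0))
  · rw [← him]
    refine (hh.hausdorffMeasure_image_le (inv_pos.2 hs0) s.coe_nonneg).trans_lt ?_
    have hs1 : ((s⁻¹ : ℝ≥0) : ℝ) * s = 1 := by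
      rw [NNReal.coe_inv]
      exact inv_mul_cancel₀ (by exact_mod_cast hs0.ne')
    rw [hs1, hausdorffMeasure_real]
    exact ENNReal.mul_lt_top (ENNReal.rpow_lt_top_of_nonneg s.coe_nonneg ENNReal.coe_ne_top)
      measure_Icc_lt_top

theorem IsFractal.ballsPosFinite {s : ℝ} (hs : 0 ≤ s) {S : Set X} (hS : IsFractal s S) :
    BallsPosFinite (μH[s] : Measure S) := by
  intro x r hr
  rw [← isometry_subtype_coe.hausdorffMeasure_image (.inl hs)]
  have him : Subtype.val '' Metric.ball x r = S ∩ Metric.ball (x : X) r := by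
    ext y
    constructor
    · rintro ⟨z, hz, rfl⟩
      exact ⟨z.2, hz⟩
    · rintro ⟨hy, hyr⟩
      exact ⟨⟨y, hy⟩, hyr, rfl⟩
  rw [him]
  exact ⟨hS.measure_pos x x.2 r hr, (measure_mono inter_subset_left).trans_lt hS.measure_lt_top⟩

theorem IsFractal.isFiniteMeasure {s : ℝ} (hs : 0 ≤ s) {S : Set X} (hS : IsFractal s S) :
    IsFiniteMeasure (μH[s] : Measure S) := by
  refine ⟨?_⟩
  rw [← isometry_subtype_coe.hausdorffMeasure_image (.inl hs), image_univ, Subtype.range_coe]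
  exact hS.measure_lt_top

end Arcs

/-- A measure without atoms on a separable space charges a closed set with empty interior. -/
theorem exists_isClosed_interior_eq_empty {X : Type*} [MetricSpace X] [MeasurableSpace X]
    [BorelSpace X] [SeparableSpace X] (μ : Measure X)
    [IsFiniteMeasure μ]
    [NullSingletonClass μ] (hμ : 0 < μ univ) : ∃ F : Set X, IsClosed F ∧ interior F = ∅ ∧ 0 < μ F := by
  obtain ⟨D, hD, hdense⟩ := exists_countable_dense X
  -- A countable dense set is null, so it has an open neighbourhood of less than full measure; the
  -- complement is the required set.
  obtain ⟨U, hDU, hU, hlt⟩ := D.exists_isOpen_lt_of_lt (μ univ) (by rwa [hD.measure_zero μ])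
  refine ⟨Uᶜ, hU.isClosed_compl, ?_, ?_⟩
  · rw [interior_compl, (hdense.mono hDU).closure_eq, compl_univ]
  · rw [measure_compl hU.measurableSet (measure_ne_top _ _)]
    exact tsub_pos_of_lt hlt

/-- Passing from `x` to `y` loses nothing in the inequality and multiplies the a priori bound `M` by
`q`, so the error after `n` passages is `q ^ n * |M|`. This is the engine of all the self-similarity
arguments below. -/
theorem le_of_descent {α : Type*} {Q : α → Prop} {φ ψ : α → ℝ} {q C M : ℝ} (hq0 : 0 ≤ q)
    (hq : q < 1) (hC : 0 ≤ C) (hM : ∀ x, Q x → φ x ≤ M) (hψ : ∀ x, 0 ≤ ψ x)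
    (h : ∀ x, Q x → φ x ≤ C * ψ x ∨ ∃ y, Q y ∧ φ x ≤ q * φ y ∧ q * ψ y ≤ ψ x)
    {x : α} (hx : Q x) : φ x ≤ C * ψ x := by
  have hn : ∀ n : ℕ, ∀ x, Q x → φ x ≤ C * ψ x + q ^ n * |M| := by
    intro n
    induction n with
    | zero =>
      intro x hx
      have h1 := mul_nonneg hC (hψ x)
      linarith [hM x hx, le_abs_self M, one_mul |M|]
    | succ n ih =>
      intro x hx
      rcases h x hx with h1 | ⟨y, hy, h1, h2⟩
      · have : 0 ≤ q ^ (n + 1) * |M| := by positivity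
        linarith
      · calc φ x ≤ q * (C * ψ y + q ^ n * |M|) :=
              h1.trans (mul_le_mul_of_nonneg_left (ih y hy) hq0)
          _ = C * (q * ψ y) + q ^ (n + 1) * |M| := by ring
          _ ≤ C * ψ x + q ^ (n + 1) * |M| := by gcongr
  have hlim : Filter.Tendsto (fun n : ℕ => C * ψ x + q ^ n * |M|) Filter.atTop
      (nhds (C * ψ x + 0 * |M|)) :=
    ((tendsto_pow_atTop_nhds_zero_of_lt_one hq0 hq).mul_const _).const_add _
  rw [zero_mul, add_zero] at hlim
  exact ge_of_tendsto' hlim fun n => hn n x hx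

/-! ### Position of the four pieces of the von Koch curve. -/

section KochGeometry

theorem kochRot_one : kochRot 1 = ⟨1 / 2, √3 / 2⟩ := by
  change Complex.exp ((Real.pi / 3 : ℝ) * Complex.I) = _
  apply Complex.ext <;> simp only [Complex.exp_ofReal_mul_I_re, Complex.exp_ofReal_mul_I_im,
    Real.cos_pi_div_three, Real.sin_pi_div_three]

theorem kochRot_two : kochRot 2 = ⟨1 / 2, -(√3 / 2)⟩ := by
  change Complex.exp ((-(Real.pi / 3) : ℝ) * Complex.I) = _
  apply Complex.ext <;> simp only [Complex.exp_ofReal_mul_I_re, Complex.exp_ofReal_mul_I_im,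
    Real.cos_neg, Real.sin_neg, Real.cos_pi_div_three, Real.sin_pi_div_three]

theorem kochMap_zero (z : ℂ) : kochMap 0 z = ⟨z.re / 3, z.im / 3⟩ := by
  apply Complex.ext <;> simp [kochMap, kochShift, kochRot]

theorem kochMap_one (z : ℂ) :
    kochMap 1 z = ⟨1 / 3 + (z.re - √3 * z.im) / 6, (√3 * z.re + z.im) / 6⟩ := by
  apply Complex.ext <;> simp [kochMap, kochShift, kochRot_one] <;> ring

theorem kochMap_two (z : ℂ) :
    kochMap 2 z = ⟨1 / 2 + (z.re + √3 * z.im) / 6, √3 / 6 + (z.im - √3 * z.re) / 6⟩ := by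
  apply Complex.ext <;> simp [kochMap, kochShift, kochRot_two] <;> ring

theorem kochMap_three (z : ℂ) : kochMap 3 z = ⟨2 / 3 + z.re / 3, z.im / 3⟩ := by
  apply Complex.ext <;> simp [kochMap, kochShift, kochRot]

/-- The triangle with vertices `0`, `1` and `1/2 + (√3/6) i`. -/
def kochTriangle : Set ℂ :=
  {z | 0 ≤ √3 * z.im ∧ √3 * z.im ≤ z.re ∧ √3 * z.im ≤ 1 - z.re}

theorem isClosed_kochTriangle : IsClosed kochTriangle := by
  have him : Continuous fun z : ℂ => √3 * z.im := by fun_prop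
  have hre : Continuous fun z : ℂ => z.re := by fun_prop
  exact (isClosed_le continuous_const him).inter
    ((isClosed_le him hre).inter (isClosed_le him (continuous_const.sub hre)))

theorem zero_mem_kochTriangle : (0 : ℂ) ∈ kochTriangle := by
  simp [kochTriangle]

theorem kochMap_mem_kochTriangle (i : Fin 4) {z : ℂ} (hz : z ∈ kochTriangle) :
    kochMap i z ∈ kochTriangle := by
  obtain ⟨h1, h2, h3⟩ := hz
  have h3' : √3 * √3 = 3 := Real.mul_self_sqrt (by norm_num)
  fin_cases i
  · change kochMap 0 z ∈ kochTriangle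
    rw [kochMap_zero]
    have e : √3 * (z.im / 3) = √3 * z.im / 3 := by ring
    refine ⟨?_, ?_, ?_⟩ <;> dsimp only <;> rw [e] <;> linarith
  · change kochMap 1 z ∈ kochTriangle
    rw [kochMap_one]
    have e : √3 * ((√3 * z.re + z.im) / 6) = z.re / 2 + √3 * z.im / 6 := by
      linear_combination z.re / 6 * h3'
    refine ⟨?_, ?_, ?_⟩ <;> dsimp only <;> rw [e] <;> linarith
  · change kochMap 2 z ∈ kochTriangle
    rw [kochMap_two]
    have e : √3 * (√3 / 6 + (z.im - √3 * z.re) / 6) = 1 / 2 - z.re / 2 + √3 * z.im / 6 := by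
      linear_combination (1 / 6 - z.re / 6) * h3'
    refine ⟨?_, ?_, ?_⟩ <;> dsimp only <;> rw [e] <;> linarith
  · change kochMap 3 z ∈ kochTriangle
    rw [kochMap_three]
    have e : √3 * (z.im / 3) = √3 * z.im / 3 := by ring
    refine ⟨?_, ?_, ?_⟩ <;> dsimp only <;> rw [e] <;> linarith

theorem kochMap_mem_kochCurve (i : Fin 4) {z : ℂ} (hz : z ∈ kochCurve) :
    kochMap i z ∈ kochCurve := by
  rw [kochCurve_eq]
  exact mem_iUnion.2 ⟨i, mem_image_of_mem _ hz⟩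

theorem exists_kochMap_eq {z : ℂ} (hz : z ∈ kochCurve) :
    ∃ i, ∃ w ∈ kochCurve, kochMap i w = z := by
  rw [kochCurve_eq] at hz
  exact mem_iUnion.1 hz

theorem kochCurve_subset_kochTriangle : kochCurve ⊆ kochTriangle := by
  obtain ⟨M, hM⟩ := kochCurve_isCompact.isBounded.exists_norm_le
  have hne : kochTriangle.Nonempty := ⟨0, zero_mem_kochTriangle⟩
  intro z hz
  -- The maps preserve the triangle and contract by `1/3`, so the bounded distance to it must vanish
  -- on the curve. The form `0 * 0` is `C * ψ` with `C = 0` and `ψ = 0`.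
  have h : Metric.infDist z kochTriangle ≤ 0 * 0 := by
    refine le_of_descent (Q := (· ∈ kochCurve)) (φ := fun z => Metric.infDist z kochTriangle)
      (ψ := fun _ => 0) (q := 1 / 3) (M := M) (by norm_num) (by norm_num) le_rfl
      (fun x hx => ?_) (fun _ => le_rfl) (fun x hx => .inr ?_) hz
    · exact (Metric.infDist_le_dist_of_mem zero_mem_kochTriangle).trans
        ((dist_zero_right x).trans_le (hM x hx))
    · obtain ⟨i, w, hw, rfl⟩ := exists_kochMap_eq hx
      refine ⟨w, hw, ?_, by simp⟩
      obtain ⟨v, hv, hwv⟩ := isClosed_kochTriangle.exists_infDist_eq_dist hne w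
      refine (Metric.infDist_le_dist_of_mem (kochMap_mem_kochTriangle i hv)).trans_eq ?_
      rw [dist_kochMap, hwv]
      ring
  rw [zero_mul] at h
  exact (isClosed_kochTriangle.mem_iff_infDist_zero hne).2 (h.antisymm Metric.infDist_nonneg)

theorem abs_im_le_of_mem_kochTriangle {z : ℂ} (hz : z ∈ kochTriangle) : |z.im| ≤ √3 * z.im := by
  have h1 : 1 ≤ √3 := Real.one_le_sqrt.2 (by norm_num)
  have h0 : 0 ≤ z.im := (mul_nonneg_iff_of_pos_left (by positivity)).1 hz.1
  rw [abs_of_nonneg h0]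
  exact le_mul_of_one_le_left h0 h1

theorem norm_le_of_mem_kochTriangle {z : ℂ} (hz : z ∈ kochTriangle) : ‖z‖ ≤ 2 * z.re := by
  refine (Complex.norm_le_abs_re_add_abs_im z).trans ?_
  rw [abs_of_nonneg (hz.1.trans hz.2.1)]
  linarith [abs_im_le_of_mem_kochTriangle hz, hz.2.1]

theorem norm_one_sub_le_of_mem_kochTriangle {z : ℂ} (hz : z ∈ kochTriangle) :
    ‖1 - z‖ ≤ 2 * (1 - z.re) := by
  refine (Complex.norm_le_abs_re_add_abs_im _).trans ?_
  have h1 : (1 - z).re = 1 - z.re := by simp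
  have h2 : |(1 - z).im| = |z.im| := by simp
  rw [h1, h2, abs_of_nonneg (hz.1.trans hz.2.2)]
  linarith [abs_im_le_of_mem_kochTriangle hz, hz.2.2]

theorem re_nonneg_of_mem_kochTriangle {z : ℂ} (hz : z ∈ kochTriangle) : 0 ≤ z.re :=
  hz.1.trans hz.2.1

theorem re_le_one_of_mem_kochTriangle {z : ℂ} (hz : z ∈ kochTriangle) : z.re ≤ 1 :=
  sub_nonneg.1 (hz.1.trans hz.2.2)

theorem kochMap_one_eq_kochMap_zero {i j : Fin 4} (hij : (j : ℕ) = i + 1) :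
    kochMap i 1 = kochMap j 0 := by
  fin_cases i <;> fin_cases j <;> simp at hij
  · change kochMap 0 1 = kochMap 1 0
    rw [kochMap_zero, kochMap_one]
    simp
  · change kochMap 1 1 = kochMap 2 0
    rw [kochMap_one, kochMap_two]
    apply Complex.ext <;> norm_num
  · change kochMap 2 1 = kochMap 3 0
    rw [kochMap_two, kochMap_three]
    apply Complex.ext
    · norm_num
    · norm_num
      ring

theorem re_sub_re_le_dist (z w : ℂ) : w.re - z.re ≤ dist z w := by
  rw [dist_comm, dist_eq_norm, ← Complex.sub_re]
  exact Complex.re_le_norm _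

theorem dist_kochMap_le_of_adjacent {i j : Fin 4} (hij : (j : ℕ) = i + 1) (z w : ℂ) :
    dist (kochMap i z) (kochMap j w) ≤ (‖1 - z‖ + ‖w‖) / 3 := by
  have h := dist_triangle (kochMap i z) (kochMap i 1) (kochMap j w)
  rw [dist_kochMap, kochMap_one_eq_kochMap_zero hij, dist_kochMap, dist_comm z 1,
    dist_eq_norm 1 z, dist_zero_left] at h
  linarith

theorem norm_one_sub_le_dist_add {i j : Fin 4} (hij : (j : ℕ) = i + 1) (z w : ℂ) :
    ‖1 - z‖ ≤ 3 * dist (kochMap i z) (kochMap j w) + ‖w‖ := by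
  have h := dist_triangle (kochMap i z) (kochMap j w) (kochMap i 1)
  rw [dist_kochMap, kochMap_one_eq_kochMap_zero hij, dist_kochMap, dist_comm z, dist_eq_norm,
    dist_zero_right] at h
  linarith

theorem norm_le_dist_add {i j : Fin 4} (hij : (j : ℕ) = i + 1) (z w : ℂ) :
    ‖w‖ ≤ 3 * dist (kochMap i z) (kochMap j w) + ‖1 - z‖ := by
  have h := dist_triangle_left (kochMap j w) (kochMap j 0) (kochMap i z)
  rw [dist_kochMap, ← kochMap_one_eq_kochMap_zero hij, dist_kochMap, dist_comm z, dist_eq_norm 1,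
    dist_zero_right] at h
  linarith

/-- The images of the triangle project to `[0,1/3]`, `[1/3,1/2]`, `[1/2,2/3]`, `[2/3,1]` on the real
axis. The gap of real parts thus bounds the distance from one of the points to the common vertex,
and the triangle inequality handles the other. The constants that arise are at most 12. -/
theorem norm_le_dist_of_adjacent {i j : Fin 4} (hij : (j : ℕ) = i + 1) {z w : ℂ}
    (hz : z ∈ kochTriangle) (hw : w ∈ kochTriangle) :
    ‖1 - z‖ ≤ 15 * dist (kochMap i z) (kochMap j w) ∧
      ‖w‖ ≤ 15 * dist (kochMap i z) (kochMap j w) := by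
  have hre := re_sub_re_le_dist (kochMap i z) (kochMap j w)
  have h1 := norm_one_sub_le_dist_add hij z w
  have h2 := norm_le_dist_add hij z w
  have h3 := norm_one_sub_le_of_mem_kochTriangle hz
  have h4 := norm_le_of_mem_kochTriangle hw
  have h5 := dist_nonneg (x := kochMap i z) (y := kochMap j w)
  obtain ⟨hz1, hz2, hz3⟩ := hz
  obtain ⟨hw1, hw2, hw3⟩ := hw
  have e1 : (kochMap 1 z).re = 1 / 3 + (z.re - √3 * z.im) / 6 := by rw [kochMap_one]
  have e1' : (kochMap 1 w).re = 1 / 3 + (w.re - √3 * w.im) / 6 := by rw [kochMap_one]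
  have e2 : (kochMap 2 z).re = 1 / 2 + (z.re + √3 * z.im) / 6 := by rw [kochMap_two]
  have e2' : (kochMap 2 w).re = 1 / 2 + (w.re + √3 * w.im) / 6 := by rw [kochMap_two]
  have e0 : (kochMap 0 z).re = z.re / 3 := by rw [kochMap_zero]
  have e3' : (kochMap 3 w).re = 2 / 3 + w.re / 3 := by rw [kochMap_three]
  obtain ⟨rfl, rfl⟩ | ⟨rfl, rfl⟩ | ⟨rfl, rfl⟩ :
      (i = 0 ∧ j = 1) ∨ (i = 1 ∧ j = 2) ∨ (i = 2 ∧ j = 3) := by omega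
  · constructor <;> linarith
  · constructor <;> linarith
  · constructor <;> linarith

theorem one_le_dist_of_not_adjacent {i j : Fin 4} (hij : (i : ℕ) + 2 ≤ j) {z w : ℂ}
    (hz : z ∈ kochTriangle) (hw : w ∈ kochTriangle) :
    1 ≤ 6 * dist (kochMap i z) (kochMap j w) := by
  have hre := re_sub_re_le_dist (kochMap i z) (kochMap j w)
  have h3 := re_le_one_of_mem_kochTriangle hz
  have h4 := re_nonneg_of_mem_kochTriangle hw
  obtain ⟨hz1, hz2, hz3⟩ := hz
  obtain ⟨hw1, hw2, hw3⟩ := hw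
  have e0 : (kochMap 0 z).re = z.re / 3 := by rw [kochMap_zero]
  have e1 : (kochMap 1 z).re = 1 / 3 + (z.re - √3 * z.im) / 6 := by rw [kochMap_one]
  have e2' : (kochMap 2 w).re = 1 / 2 + (w.re + √3 * w.im) / 6 := by rw [kochMap_two]
  have e3' : (kochMap 3 w).re = 2 / 3 + w.re / 3 := by rw [kochMap_three]
  obtain ⟨rfl, rfl⟩ | ⟨rfl, rfl⟩ | ⟨rfl, rfl⟩ :
      (i = 0 ∧ j = 2) ∨ (i = 0 ∧ j = 3) ∨ (i = 1 ∧ j = 3) := by omega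
  · linarith
  · linarith
  · linarith

theorem one_le_norm_kochMap {i : Fin 4} (hi : i ≠ 0) {z : ℂ} (hz : z ∈ kochTriangle) :
    1 ≤ 3 * ‖kochMap i z‖ := by
  have hre := Complex.re_le_norm (kochMap i z)
  obtain ⟨hz1, hz2, hz3⟩ := hz
  have e1 : (kochMap 1 z).re = 1 / 3 + (z.re - √3 * z.im) / 6 := by rw [kochMap_one]
  have e2 : (kochMap 2 z).re = 1 / 2 + (z.re + √3 * z.im) / 6 := by rw [kochMap_two]
  have e3 : (kochMap 3 z).re = 2 / 3 + z.re / 3 := by rw [kochMap_three]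
  obtain rfl | rfl | rfl : i = 1 ∨ i = 2 ∨ i = 3 := by omega
  · linarith
  · linarith
  · linarith

theorem one_le_norm_one_sub_kochMap {i : Fin 4} (hi : i ≠ 3) {z : ℂ} (hz : z ∈ kochTriangle) :
    1 ≤ 3 * ‖1 - kochMap i z‖ := by
  have hre := Complex.re_le_norm (1 - kochMap i z)
  rw [Complex.sub_re, Complex.one_re] at hre
  obtain ⟨hz1, hz2, hz3⟩ := hz
  have e0 : (kochMap 0 z).re = z.re / 3 := by rw [kochMap_zero]
  have e1 : (kochMap 1 z).re = 1 / 3 + (z.re - √3 * z.im) / 6 := by rw [kochMap_one]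
  have e2 : (kochMap 2 z).re = 1 / 2 + (z.re + √3 * z.im) / 6 := by rw [kochMap_two]
  obtain rfl | rfl | rfl : i = 0 ∨ i = 1 ∨ i = 2 := by omega
  · linarith
  · linarith
  · linarith

theorem norm_kochMap_zero (z : ℂ) : ‖kochMap 0 z‖ = ‖z‖ / 3 := by
  have h := dist_kochMap 0 z 0
  have h0 : kochMap 0 0 = 0 := by simp [kochMap, kochShift]
  rwa [h0, dist_zero_right, dist_zero_right] at h

theorem norm_one_sub_kochMap_three (z : ℂ) : ‖1 - kochMap 3 z‖ = ‖1 - z‖ / 3 := by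
  have h := dist_kochMap 3 1 z
  have h0 : kochMap 3 1 = 1 := by
    rw [kochMap_three]
    apply Complex.ext <;> norm_num
  rwa [h0, dist_eq_norm, dist_eq_norm] at h

end KochGeometry

/-! ### The bi-Hölder coordinate on the von Koch curve. -/

section KochParametrization

/-- The similarity dimension of the von Koch curve. -/
noncomputable def kochDim : ℝ := Real.log 4 / Real.log 3

theorem one_lt_kochDim : 1 < kochDim := by
  rw [kochDim, one_lt_div (Real.log_pos (by norm_num))]
  exact Real.log_lt_log (by norm_num) (by norm_num)

theorem kochDim_pos : 0 < kochDim := zero_lt_one.trans one_lt_kochDim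

theorem three_rpow_kochDim : (3 : ℝ) ^ kochDim = 4 := by
  rw [kochDim, Real.rpow_def_of_pos (by norm_num),
    mul_div_cancel₀ _ (Real.log_pos (by norm_num)).ne', Real.exp_log (by norm_num)]

theorem div_three_rpow_kochDim {x : ℝ} (hx : 0 ≤ x) : (x / 3) ^ kochDim = x ^ kochDim / 4 := by
  rw [Real.div_rpow hx (by norm_num), three_rpow_kochDim]

theorem rpow_kochDim_le {x y : ℝ} (hx : 0 ≤ x) (hxy : x ≤ y) : x ^ kochDim ≤ y ^ kochDim :=
  Real.rpow_le_rpow hx hxy kochDim_pos.le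

theorem one_le_four_mul_rpow {x : ℝ} (hx : 1 ≤ 3 * x) : 1 ≤ 4 * x ^ kochDim := by
  have h := Real.one_le_rpow hx kochDim_pos.le
  rwa [Real.mul_rpow (by norm_num) (by linarith), three_rpow_kochDim] at h

theorem add_rpow_kochDim_le {x y : ℝ} (hx : 0 ≤ x) (hy : 0 ≤ y) :
    (x + y) ^ kochDim ≤ 2 ^ kochDim * (x ^ kochDim + y ^ kochDim) := by
  have hm : 0 ≤ max x y := hx.trans (le_max_left _ _)
  calc (x + y) ^ kochDim ≤ (2 * max x y) ^ kochDim :=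
        rpow_kochDim_le (by positivity) (by linarith [le_max_left x y, le_max_right x y])
    _ = 2 ^ kochDim * (max x y) ^ kochDim := Real.mul_rpow (by norm_num) hm
    _ ≤ 2 ^ kochDim * (x ^ kochDim + y ^ kochDim) := by
        gcongr
        rcases max_choice x y with h | h <;> rw [h]
        · exact le_add_of_nonneg_right (Real.rpow_nonneg hy _)
        · exact le_add_of_nonneg_left (Real.rpow_nonneg hx _)

/-- The correspondence between the points of the von Koch curve and their parameters in `[0, 1]`:
the largest set with `p ∈ kochGraph` only if `p = (fᵢ z, (i + t) / 4)` with
`(z, t) ∈ kochGraph`. -/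
def kochGraph : Set (ℂ × ℝ) :=
  {p | ∃ S : Set (ℂ × ℝ), p ∈ S ∧ S ⊆ kochCurve ×ˢ Icc 0 1 ∧
    ∀ p ∈ S, ∃ i : Fin 4, ∃ q ∈ S, p = (kochMap i q.1, ((i : ℕ) + q.2) / 4)}

theorem fst_mem_of_mem_kochGraph {p : ℂ × ℝ} (hp : p ∈ kochGraph) : p.1 ∈ kochCurve := by
  obtain ⟨S, hpS, hS, -⟩ := hp
  exact (hS hpS).1

theorem snd_mem_of_mem_kochGraph {p : ℂ × ℝ} (hp : p ∈ kochGraph) : p.2 ∈ Icc (0 : ℝ) 1 := by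
  obtain ⟨S, hpS, hS, -⟩ := hp
  exact (hS hpS).2

theorem fst_mem_kochTriangle {p : ℂ × ℝ} (hp : p ∈ kochGraph) : p.1 ∈ kochTriangle :=
  kochCurve_subset_kochTriangle (fst_mem_of_mem_kochGraph hp)

theorem exists_of_mem_kochGraph {p : ℂ × ℝ} (hp : p ∈ kochGraph) :
    ∃ i : Fin 4, ∃ q ∈ kochGraph, p = (kochMap i q.1, ((i : ℕ) + q.2) / 4) := by
  obtain ⟨S, hpS, hS, h⟩ := hp
  obtain ⟨i, q, hq, rfl⟩ := h p hpS
  exact ⟨i, q, ⟨S, hq, hS, h⟩, rfl⟩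

theorem map_mem_kochGraph (i : Fin 4) {q : ℂ × ℝ} (hq : q ∈ kochGraph) :
    (kochMap i q.1, ((i : ℕ) + q.2) / 4) ∈ kochGraph := by
  obtain ⟨S, hqS, hS, h⟩ := hq
  refine ⟨insert (kochMap i q.1, ((i : ℕ) + q.2) / 4) S, mem_insert _ _,
    insert_subset ⟨kochMap_mem_kochCurve i (hS hqS).1, ?_⟩ hS, ?_⟩
  · have hi : ((i : ℕ) : ℝ) ≤ 3 := by exact_mod_cast Nat.le_of_lt_succ i.2
    have hi0 : (0 : ℝ) ≤ (i : ℕ) := Nat.cast_nonneg _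
    obtain ⟨h0, h1⟩ := (hS hqS).2
    constructor <;> dsimp only <;> linarith
  · rintro p (rfl | hp)
    · exact ⟨i, q, mem_insert_of_mem _ hqS, rfl⟩
    · obtain ⟨j, r, hr, hp⟩ := h p hp
      exact ⟨j, r, mem_insert_of_mem _ hr, hp⟩

theorem exists_mem_kochGraph {z : ℂ} (hz : z ∈ kochCurve) : ∃ t, (z, t) ∈ kochGraph := by
  have hex : ∀ w : kochCurve, ∃ i, ∃ v : kochCurve, kochMap i v = w := fun w => by
    obtain ⟨i, v, hv, h⟩ := exists_kochMap_eq w.2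
    exact ⟨i, ⟨v, hv⟩, h⟩
  choose digit next hnext using hex
  -- The base 4 number whose digits are a chosen itinerary of `w`. Shifting the itinerary gives
  -- `hparam`, which makes the graph of `param` an admissible `S`.
  let param (w : kochCurve) : ℝ := Real.ofDigits fun n => digit (next^[n] w)
  have hparam : ∀ w, param w = ((digit w : ℕ) + param (next w)) / 4 := by
    intro w
    have h := Real.ofDigits_eq_sum_add_ofDigits (fun n => digit (next^[n] w)) 1
    simp only [Finset.sum_range_one, Real.ofDigitsTerm, Function.iterate_succ_apply,
      Function.iterate_zero, id_eq] at h
    change param w = _ + _ * param (next w) at h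
    rw [h]
    push_cast
    ring
  refine ⟨param ⟨z, hz⟩, range fun w : kochCurve => ((w : ℂ), param w), ⟨⟨z, hz⟩, rfl⟩, ?_, ?_⟩
  · rintro _ ⟨w, rfl⟩
    exact ⟨w.2, Real.ofDigits_nonneg _, Real.ofDigits_le_one _⟩
  · rintro _ ⟨w, rfl⟩
    refine ⟨digit w, _, ⟨next w, rfl⟩, ?_⟩
    dsimp only
    rw [hnext, ← hparam]

theorem one_le_of_ne_zero {i : Fin 4} (hi : i ≠ 0) : (1 : ℝ) ≤ (i : ℕ) := by
  exact_mod_cast Nat.one_le_iff_ne_zero.2 fun h => hi (Fin.ext h)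

/-- While the leading digit is 0, both sides scale by `1/4`, because `3 ^ kochDim = 4`. At any other
digit the point has norm at least `1/3`, and the right side is at least 1. The next three lemmas are
the analogue at the endpoint 1 and the two converse bounds. -/
theorem snd_le_of_mem_kochGraph {p : ℂ × ℝ} (hp : p ∈ kochGraph) :
    p.2 ≤ 4 * ‖p.1‖ ^ kochDim := by
  refine le_of_descent (Q := (· ∈ kochGraph)) (φ := fun p => p.2)
    (ψ := fun p => ‖p.1‖ ^ kochDim) (q := 1 / 4) (M := 1) (by norm_num) (by norm_num)
    (by norm_num) (fun p hp => (snd_mem_of_mem_kochGraph hp).2) (fun p => by positivity)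
    (fun p hp => ?_) hp
  obtain ⟨i, q, hq, rfl⟩ := exists_of_mem_kochGraph hp
  by_cases hi : i = 0
  · subst hi
    refine .inr ⟨q, hq, by simp; linarith, ?_⟩
    rw [norm_kochMap_zero, div_three_rpow_kochDim (norm_nonneg _)]
    linarith
  · exact .inl ((snd_mem_of_mem_kochGraph hp).2.trans
      (one_le_four_mul_rpow (one_le_norm_kochMap hi (fst_mem_kochTriangle hq))))

theorem one_sub_snd_le_of_mem_kochGraph {p : ℂ × ℝ} (hp : p ∈ kochGraph) :
    1 - p.2 ≤ 4 * ‖1 - p.1‖ ^ kochDim := by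
  refine le_of_descent (Q := (· ∈ kochGraph)) (φ := fun p => 1 - p.2)
    (ψ := fun p => ‖1 - p.1‖ ^ kochDim) (q := 1 / 4) (M := 1) (by norm_num) (by norm_num)
    (by norm_num) (fun p hp => by linarith [(snd_mem_of_mem_kochGraph hp).1])
    (fun p => by positivity) (fun p hp => ?_) hp
  obtain ⟨i, q, hq, rfl⟩ := exists_of_mem_kochGraph hp
  by_cases hi : i = 3
  · subst hi
    refine .inr ⟨q, hq, by norm_num; linarith, ?_⟩
    rw [norm_one_sub_kochMap_three, div_three_rpow_kochDim (norm_nonneg _)]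
    linarith
  · exact .inl (le_trans (by linarith [(snd_mem_of_mem_kochGraph hp).1])
      (one_le_four_mul_rpow (one_le_norm_one_sub_kochMap hi (fst_mem_kochTriangle hq))))

theorem norm_rpow_le_of_mem_kochGraph {p : ℂ × ℝ} (hp : p ∈ kochGraph) :
    ‖p.1‖ ^ kochDim ≤ 4 * 2 ^ kochDim * p.2 := by
  have hM : ∀ p ∈ kochGraph, ‖p.1‖ ^ kochDim ≤ 2 ^ kochDim := fun p hp => by
    have hT := fst_mem_kochTriangle hp
    refine rpow_kochDim_le (norm_nonneg _) ?_
    linarith [norm_le_of_mem_kochTriangle hT, re_le_one_of_mem_kochTriangle hT]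
  have h := le_of_descent (Q := (· ∈ kochGraph)) (φ := fun p => ‖p.1‖ ^ kochDim)
    -- The descent needs `ψ` nonnegative everywhere, not only on the graph. The factor 4 in `C`
    -- reflects that a nonzero leading digit forces a parameter of at least `1/4`.
    (ψ := fun p => max p.2 0) (q := 1 / 4) (M := 2 ^ kochDim) (C := 4 * 2 ^ kochDim)
    (by norm_num) (by norm_num) (by positivity) hM (fun p => le_max_right _ _)
    (fun p hp => ?_) hp
  · rwa [max_eq_left (snd_mem_of_mem_kochGraph hp).1] at h
  obtain ⟨i, q, hq, rfl⟩ := exists_of_mem_kochGraph hp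
  have hq0 := (snd_mem_of_mem_kochGraph hq).1
  by_cases hi : i = 0
  · subst hi
    refine .inr ⟨q, hq, ?_, ?_⟩
    · rw [norm_kochMap_zero, div_three_rpow_kochDim (norm_nonneg _)]
      linarith
    · rw [max_eq_left hq0]
      refine le_trans ?_ (le_max_left _ _)
      simp
      linarith
  · refine .inl ((hM _ hp).trans ?_)
    have h4 : (1 : ℝ) ≤ 4 * max (((i : ℕ) + q.2) / 4) 0 := by
      have := le_max_left (((i : ℕ) + q.2) / 4) 0
      linarith [one_le_of_ne_zero hi]
    nlinarith [Real.rpow_nonneg (zero_le_two (α := ℝ)) kochDim]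

theorem norm_one_sub_rpow_le_of_mem_kochGraph {p : ℂ × ℝ} (hp : p ∈ kochGraph) :
    ‖1 - p.1‖ ^ kochDim ≤ 4 * 2 ^ kochDim * (1 - p.2) := by
  have hM : ∀ p ∈ kochGraph, ‖1 - p.1‖ ^ kochDim ≤ 2 ^ kochDim := fun p hp => by
    have hT := fst_mem_kochTriangle hp
    refine rpow_kochDim_le (norm_nonneg _) ?_
    linarith [norm_one_sub_le_of_mem_kochTriangle hT, re_nonneg_of_mem_kochTriangle hT]
  have h := le_of_descent (Q := (· ∈ kochGraph)) (φ := fun p => ‖1 - p.1‖ ^ kochDim)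
    (ψ := fun p => max (1 - p.2) 0) (q := 1 / 4) (M := 2 ^ kochDim) (C := 4 * 2 ^ kochDim)
    (by norm_num) (by norm_num) (by positivity) hM (fun p => le_max_right _ _)
    (fun p hp => ?_) hp
  · rwa [max_eq_left (sub_nonneg.2 (snd_mem_of_mem_kochGraph hp).2)] at h
  obtain ⟨i, q, hq, rfl⟩ := exists_of_mem_kochGraph hp
  have hq1 := (snd_mem_of_mem_kochGraph hq).2
  by_cases hi : i = 3
  · subst hi
    refine .inr ⟨q, hq, ?_, ?_⟩
    · rw [norm_one_sub_kochMap_three, div_three_rpow_kochDim (norm_nonneg _)]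
      linarith
    · rw [max_eq_left (sub_nonneg.2 hq1)]
      refine le_trans ?_ (le_max_left _ _)
      norm_num
      linarith
  · refine .inl ((hM _ hp).trans ?_)
    have h4 : (1 : ℝ) ≤ 4 * max (1 - ((i : ℕ) + q.2) / 4) 0 := by
      have := le_max_left (1 - ((i : ℕ) + q.2) / 4) 0
      have hi2 : ((i : ℕ) : ℝ) ≤ 2 := by
        have : (i : ℕ) ≤ 2 := by omega
        exact_mod_cast this
      linarith
    nlinarith [Real.rpow_nonneg (zero_le_two (α := ℝ)) kochDim]

/-- The distance of parameters is controlled by the distance of points in different pieces. -/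
theorem abs_sub_le_of_lt {i j : Fin 4} (hij : i < j) {p q : ℂ × ℝ} (hp : p ∈ kochGraph)
    (hq : q ∈ kochGraph) :
    |((i : ℕ) + p.2) / 4 - ((j : ℕ) + q.2) / 4| ≤
      2 * 15 ^ kochDim * dist (kochMap i p.1) (kochMap j q.1) ^ kochDim := by
  rw [mul_assoc, ← Real.mul_rpow (by norm_num) dist_nonneg]
  have hpT := fst_mem_kochTriangle hp
  have hqT := fst_mem_kochTriangle hq
  have hd := dist_nonneg (x := kochMap i p.1) (y := kochMap j q.1)
  rcases (Nat.succ_le_of_lt (Fin.lt_def.1 hij)).eq_or_lt with hadj | hfar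
  -- The parameters differ by `((1 - p.2) + q.2) / 4`, the sum of two distances to the common joint.
  -- Each of `1 - p.2` and `q.2` is at most 4 times the power of `15 * dist`, whence the factor 2.
  · obtain ⟨h1, h2⟩ := norm_le_dist_of_adjacent hadj.symm hpT hqT
    have h3 := rpow_kochDim_le (norm_nonneg _) h1
    have h4 := rpow_kochDim_le (norm_nonneg _) h2
    have h5 := one_sub_snd_le_of_mem_kochGraph hp
    have h6 := snd_le_of_mem_kochGraph hq
    have hj : ((j : ℕ) : ℝ) = (i : ℕ) + 1 := by rw [← hadj]; push_cast; ring
    rw [hj, abs_le]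
    constructor <;> linarith [(snd_mem_of_mem_kochGraph hp).2, (snd_mem_of_mem_kochGraph hq).1]
  · have h1 := one_le_dist_of_not_adjacent (Nat.succ_le_of_lt hfar) hpT hqT
    have h2 : 1 ≤ (15 * dist (kochMap i p.1) (kochMap j q.1)) ^ kochDim :=
      Real.one_le_rpow (by linarith) kochDim_pos.le
    have h3 := snd_mem_of_mem_kochGraph (map_mem_kochGraph i hp)
    have h4 := snd_mem_of_mem_kochGraph (map_mem_kochGraph j hq)
    have h5 := abs_sub_le_of_le_of_le h3.1 h3.2 h4.1 h4.2
    linarith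

/-- The distance of points in different pieces is controlled by the distance of parameters. -/
theorem dist_rpow_le_of_lt {i j : Fin 4} (hij : i < j) {p q : ℂ × ℝ} (hp : p ∈ kochGraph)
    (hq : q ∈ kochGraph) :
    dist (kochMap i p.1) (kochMap j q.1) ^ kochDim ≤
      4 * 4 ^ kochDim * |((i : ℕ) + p.2) / 4 - ((j : ℕ) + q.2) / 4| := by
  have h22 : (4 : ℝ) ^ kochDim = 2 ^ kochDim * 2 ^ kochDim := by
    rw [← Real.mul_rpow (by norm_num) (by norm_num)]
    norm_num
  have h2pos : (0 : ℝ) < 2 ^ kochDim := by positivity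
  have hpt := snd_mem_of_mem_kochGraph hp
  have hqt := snd_mem_of_mem_kochGraph hq
  rcases (Nat.succ_le_of_lt (Fin.lt_def.1 hij)).eq_or_lt with hadj | hfar
  -- The route passes through the common joint. The power of a sum costs one factor `2 ^ kochDim`
  -- and the endpoint bounds another; together they form `4 ^ kochDim`.
  · have h1 := rpow_kochDim_le dist_nonneg (dist_kochMap_le_of_adjacent hadj.symm p.1 q.1)
    rw [div_three_rpow_kochDim (by positivity)] at h1
    have h2 := add_rpow_kochDim_le (norm_nonneg (1 - p.1)) (norm_nonneg q.1)
    have h3 := norm_one_sub_rpow_le_of_mem_kochGraph hp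
    have h4 := norm_rpow_le_of_mem_kochGraph hq
    have hj : ((j : ℕ) : ℝ) = (i : ℕ) + 1 := by rw [← hadj]; push_cast; ring
    have habs : |((i : ℕ) + p.2) / 4 - ((j : ℕ) + q.2) / 4| = ((1 - p.2) + q.2) / 4 := by
      rw [hj, abs_of_nonpos (by linarith [hpt.2, hqt.1])]
      ring
    rw [habs, h22]
    have h5 := mul_le_mul_of_nonneg_left (add_le_add h3 h4) h2pos.le
    linarith
  · have hT1 := fst_mem_kochTriangle (map_mem_kochGraph i hp)
    have hT2 := fst_mem_kochTriangle (map_mem_kochGraph j hq)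
    have h1 : dist (kochMap i p.1) (kochMap j q.1) ≤ 4 := by
      have h := dist_triangle_right (kochMap i p.1) (kochMap j q.1) 0
      rw [dist_zero_right, dist_zero_right] at h
      linarith [norm_le_of_mem_kochTriangle hT1, re_le_one_of_mem_kochTriangle hT1,
        norm_le_of_mem_kochTriangle hT2, re_le_one_of_mem_kochTriangle hT2]
    have hj : ((i : ℕ) : ℝ) + 2 ≤ (j : ℕ) := by exact_mod_cast hfar
    have h2 : 1 ≤ 4 * |((i : ℕ) + p.2) / 4 - ((j : ℕ) + q.2) / 4| := by
      rw [abs_of_nonpos (by linarith [hpt.2, hqt.1])]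
      linarith [hpt.2, hqt.1]
    have h3 := rpow_kochDim_le dist_nonneg h1
    have h4 : (0 : ℝ) < 4 ^ kochDim := by positivity
    nlinarith

/-- Different leading digits put the points in different pieces, where the estimates hold directly.
A common digit can be stripped, which scales both quantities by exactly `1/4`. -/
theorem exists_pair_of_mem_kochGraph {x : (ℂ × ℝ) × (ℂ × ℝ)}
    (hx : x.1 ∈ kochGraph ∧ x.2 ∈ kochGraph) :
    (|x.1.2 - x.2.2| ≤ 2 * 15 ^ kochDim * dist x.1.1 x.2.1 ^ kochDim ∧
      dist x.1.1 x.2.1 ^ kochDim ≤ 4 * 4 ^ kochDim * |x.1.2 - x.2.2|) ∨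
    ∃ y : (ℂ × ℝ) × (ℂ × ℝ), (y.1 ∈ kochGraph ∧ y.2 ∈ kochGraph) ∧
      |x.1.2 - x.2.2| = 1 / 4 * |y.1.2 - y.2.2| ∧
      dist x.1.1 x.2.1 ^ kochDim = 1 / 4 * dist y.1.1 y.2.1 ^ kochDim := by
  obtain ⟨x₁, x₂⟩ := x
  obtain ⟨h1, h2⟩ := hx
  obtain ⟨i, p, hp, rfl⟩ := exists_of_mem_kochGraph h1
  obtain ⟨j, q, hq, rfl⟩ := exists_of_mem_kochGraph h2
  dsimp only
  rcases lt_trichotomy i j with hij | rfl | hij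
  · exact .inl ⟨abs_sub_le_of_lt hij hp hq, dist_rpow_le_of_lt hij hp hq⟩
  · refine .inr ⟨(p, q), ⟨hp, hq⟩, ?_, ?_⟩
    · rw [← sub_div, add_sub_add_left_eq_sub, abs_div]
      norm_num
      ring
    · rw [dist_kochMap, div_three_rpow_kochDim dist_nonneg]
      ring
  · rw [abs_sub_comm, dist_comm]
    exact .inl ⟨abs_sub_le_of_lt hij hq hp, dist_rpow_le_of_lt hij hq hp⟩

theorem abs_sub_le_of_mem_kochGraph {p q : ℂ × ℝ} (hp : p ∈ kochGraph) (hq : q ∈ kochGraph) :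
    |p.2 - q.2| ≤ 2 * 15 ^ kochDim * dist p.1 q.1 ^ kochDim := by
  refine le_of_descent
    (Q := fun x : (ℂ × ℝ) × (ℂ × ℝ) => x.1 ∈ kochGraph ∧ x.2 ∈ kochGraph)
    (φ := fun x => |x.1.2 - x.2.2|) (ψ := fun x => dist x.1.1 x.2.1 ^ kochDim)
    (q := 1 / 4) (M := 1 - 0) (by norm_num) (by norm_num) (by positivity) (fun x hx => ?_)
    (fun x => by positivity) (fun x hx => ?_) (x := (p, q)) ⟨hp, hq⟩
  · obtain ⟨h1, h2⟩ := snd_mem_of_mem_kochGraph hx.1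
    obtain ⟨h3, h4⟩ := snd_mem_of_mem_kochGraph hx.2
    exact abs_sub_le_of_le_of_le h1 h2 h3 h4
  · rcases exists_pair_of_mem_kochGraph hx with h | ⟨y, hy, h1, h2⟩
    exacts [.inl h.1, .inr ⟨y, hy, h1.le, h2.ge⟩]

theorem dist_rpow_le_of_mem_kochGraph {p q : ℂ × ℝ} (hp : p ∈ kochGraph) (hq : q ∈ kochGraph) :
    dist p.1 q.1 ^ kochDim ≤ 4 * 4 ^ kochDim * |p.2 - q.2| := by
  refine le_of_descent
    (Q := fun x : (ℂ × ℝ) × (ℂ × ℝ) => x.1 ∈ kochGraph ∧ x.2 ∈ kochGraph)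
    (φ := fun x => dist x.1.1 x.2.1 ^ kochDim) (ψ := fun x => |x.1.2 - x.2.2|)
    (q := 1 / 4) (M := Metric.diam kochCurve ^ kochDim) (by norm_num) (by norm_num)
    (by positivity) (fun x hx => ?_) (fun x => abs_nonneg _) (fun x hx => ?_) (x := (p, q))
    ⟨hp, hq⟩
  · exact rpow_kochDim_le dist_nonneg (Metric.dist_le_diam_of_mem kochCurve_isCompact.isBounded
      (fst_mem_of_mem_kochGraph hx.1) (fst_mem_of_mem_kochGraph hx.2))
  · rcases exists_pair_of_mem_kochGraph hx with h | ⟨y, hy, h1, h2⟩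
    exacts [.inl h.2, .inr ⟨y, hy, h2.le, h1.ge⟩]

/-- A nonempty closed subset of the line that is invariant under `t ↦ (i + t) / 4` contains
`[0, 1]`. -/
theorem Icc_subset_of_forall_div_four_mem {S : Set ℝ} (hS : IsClosed S) (hne : S.Nonempty)
    (h : ∀ i : Fin 4, ∀ t ∈ S, ((i : ℕ) + t) / 4 ∈ S) : Icc 0 1 ⊆ S := by
  obtain ⟨s, hs⟩ := hne
  have hex : ∀ t ∈ Icc (0 : ℝ) 1, ∃ (i : Fin 4), ∃ u ∈ Icc (0 : ℝ) 1, t = ((i : ℕ) + u) / 4 := by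
    rintro t ⟨h0, h1⟩
    rcases le_total t (1 / 4) with h2 | h2
    · exact ⟨0, 4 * t, ⟨by linarith, by linarith⟩, by norm_num⟩
    rcases le_total t (1 / 2) with h3 | h3
    · exact ⟨1, 4 * t - 1, ⟨by linarith, by linarith⟩, by norm_num⟩
    rcases le_total t (3 / 4) with h4 | h4
    · exact ⟨2, 4 * t - 2, ⟨by linarith, by linarith⟩, by norm_num⟩
    · exact ⟨3, 4 * t - 3, ⟨by linarith, by linarith⟩, by norm_num⟩
  intro t ht
  -- Removing a base 4 digit from `t` multiplies the bound for the distance to `S` by `1/4`.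
  have hd : Metric.infDist t S ≤ 0 * 0 := by
    refine le_of_descent (Q := (· ∈ Icc (0 : ℝ) 1)) (φ := fun t => Metric.infDist t S)
      (ψ := fun _ => 0) (q := 1 / 4) (M := 1 + |s|) (by norm_num) (by norm_num) le_rfl
      (fun t ht => ?_) (fun _ => le_rfl) (fun t ht => .inr ?_) ht
    · refine (Metric.infDist_le_dist_of_mem hs).trans ?_
      rw [Real.dist_eq]
      refine (abs_sub t s).trans ?_
      rw [abs_of_nonneg ht.1]
      linarith [ht.2]
    · obtain ⟨i, u, hu, rfl⟩ := hex t ht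
      refine ⟨u, hu, ?_, by simp⟩
      obtain ⟨v, hv, huv⟩ := hS.exists_infDist_eq_dist ⟨s, hs⟩ u
      refine (Metric.infDist_le_dist_of_mem (h i v hv)).trans_eq ?_
      rw [huv, Real.dist_eq, Real.dist_eq, ← sub_div, add_sub_add_left_eq_sub, abs_div]
      norm_num
      ring
  rw [zero_mul] at hd
  exact (hS.mem_iff_infDist_zero ⟨s, hs⟩).2 (hd.antisymm Metric.infDist_nonneg)

theorem isSnowflakeArc_kochCurve : IsSnowflakeArc kochDim kochCurve := by
  have hex : ∀ z : ℂ, ∃ t, z ∈ kochCurve → (z, t) ∈ kochGraph := fun z => by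
    by_cases hz : z ∈ kochCurve
    · obtain ⟨t, ht⟩ := exists_mem_kochGraph hz
      exact ⟨t, fun _ => ht⟩
    · exact ⟨0, fun h => absurd h hz⟩
  choose g hg using hex
  obtain ⟨C, hC, hLU⟩ : ∃ C : ℝ≥0, 0 < C ∧ ∀ x ∈ kochCurve, ∀ y ∈ kochCurve,
      dist x y ^ kochDim ≤ C * |g x - g y| ∧ |g x - g y| ≤ C * dist x y ^ kochDim := by
    refine ⟨max (4 * 4 ^ kochDim) (2 * 15 ^ kochDim), by positivity, fun x hx y hy => ⟨?_, ?_⟩⟩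
    · refine (dist_rpow_le_of_mem_kochGraph (hg x hx) (hg y hy)).trans ?_
      refine mul_le_mul_of_nonneg_right ?_ (abs_nonneg _)
      rw [NNReal.coe_max]
      push_cast
      exact le_max_left _ _
    · refine (abs_sub_le_of_mem_kochGraph (hg x hx) (hg y hy)).trans ?_
      refine mul_le_mul_of_nonneg_right ?_ (by positivity)
      rw [NNReal.coe_max]
      push_cast
      exact le_max_right _ _
  refine ⟨g, C, hC, Subset.antisymm ?_ ?_, hLU⟩
  · rintro _ ⟨z, hz, rfl⟩
    exact snd_mem_of_mem_kochGraph (hg z hz)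
  have hcont : ContinuousOn g kochCurve := by
    have hh : HolderOnWith C ⟨kochDim, kochDim_pos.le⟩ g kochCurve :=
      holderOnWith_of_dist_le fun x hx y hy => (hLU x hx y hy).2
    exact hh.continuousOn kochDim_pos
  refine Icc_subset_of_forall_div_four_mem (kochCurve_isCompact.image_of_continuousOn hcont).isClosed
    (kochCurve_nonempty.image g) ?_
  rintro i _ ⟨z, hz, rfl⟩
  have hi := kochMap_mem_kochCurve i hz
  refine ⟨kochMap i z, hi, ?_⟩
  -- Two parameters of one point coincide, since their difference is controlled by distance 0. Hence
  -- the arbitrarily chosen `g` satisfies `g (kochMap i z) = (i + g z) / 4`, and its range is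
  -- invariant.
  have h := abs_sub_le_of_mem_kochGraph (hg _ hi) (map_mem_kochGraph i (hg z hz))
  rw [dist_self, Real.zero_rpow kochDim_pos.ne', mul_zero] at h
  exact sub_eq_zero.1 (abs_eq_zero.1 (h.antisymm (abs_nonneg _)))

theorem isometry_add_mul {c d : ℂ} (hd : ‖d‖ = 1) : Isometry fun z => c + d * z :=
  Isometry.of_dist_eq fun z w => by
    rw [dist_add_left, dist_eq_norm, ← mul_sub, norm_mul, hd, one_mul, dist_eq_norm]

theorem norm_triVertex : ‖triVertex‖ = 1 :=
  Complex.norm_exp_ofReal_mul_I _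

theorem norm_triVertex_sub_one : ‖triVertex - 1‖ = 1 := by
  have h : triVertex = ⟨1 / 2, -(√3 / 2)⟩ := kochRot_two
  have h3 : √3 * √3 = 3 := Real.mul_self_sqrt (by norm_num)
  rw [h, Complex.norm_eq_sqrt_sq_add_sq, Real.sqrt_eq_one]
  simp only [Complex.sub_re, Complex.sub_im, Complex.one_re, Complex.one_im]
  linear_combination h3 / 4

theorem isFractal_kochCurve : IsFractal kochDim kochCurve :=
  isSnowflakeArc_kochCurve.isFractal one_lt_kochDim

theorem isFractal_kochSnowflake : IsFractal kochDim kochSnowflake := by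
  refine (isFractal_kochCurve.union ?_).union ?_
  · exact (isSnowflakeArc_kochCurve.image
      (isometry_add_mul norm_triVertex_sub_one)).isFractal one_lt_kochDim
  · have himg := isSnowflakeArc_kochCurve.image
      (isometry_add_mul (c := triVertex) ((norm_neg _).trans norm_triVertex))
    simp only [neg_mul, ← sub_eq_add_neg] at himg
    exact himg.isFractal one_lt_kochDim

theorem IsFractal.kochMeasure_pos {K : Set ℂ} (hK : IsFractal kochDim K) (hne : K.Nonempty) :
    0 < kochMeasure K univ := by
  obtain ⟨x, hx⟩ := hne
  exact ((hK.ballsPosFinite kochDim_pos.le) ⟨x, hx⟩ 1 one_pos).1.trans_le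
    (measure_mono (subset_univ _))

end KochParametrization

end NewtonLInfty

theorem theorem1p1 :
    (∀ (P : Type*) [MetricSpace P] [MeasurableSpace P] [OpensMeasurableSpace P]
        (μ : MeasureTheory.Measure P) (x₀ : P),
      BallsPosFinite μ → AlmostNoRectCurves μ → μ {x₀} = 0 →
        N1Infty μ = LInfty μ ∧ (∀ u ∈ LInfty μ, newtonNorm μ u = supNorm μ u) ∧
        (chi {x₀} ∈ N1Infty μ ∧ WeaklyQuasicontinuous μ (chi {x₀}) ∧
          ¬ Quasicontinuous μ (chi {x₀})) ∧
        (¬ IsOuterCapacity μ ∧ ¬ IsOuterForZeroSets μ) ∧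
        (∀ F : Set P, IsClosed F → interior F = ∅ → 0 < μ F →
          chi F ∈ N1Infty μ ∧ ¬ WeaklyQuasicontinuous μ (chi F))) ∧
    (∀ K : Set ℂ, K = kochCurve ∨ K = kochSnowflake →
      BallsPosFinite (kochMeasure K) ∧ AlmostNoRectCurves (kochMeasure K) ∧
        N1Infty (kochMeasure K) = LInfty (kochMeasure K) ∧
        (∀ u ∈ LInfty (kochMeasure K),
          newtonNorm (kochMeasure K) u = supNorm (kochMeasure K) u) ∧
        (∀ x₀ : K, kochMeasure K {x₀} = 0 ∧ chi {x₀} ∈ N1Infty (kochMeasure K) ∧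
          WeaklyQuasicontinuous (kochMeasure K) (chi {x₀}) ∧
          ¬ Quasicontinuous (kochMeasure K) (chi {x₀})) ∧
        (¬ IsOuterCapacity (kochMeasure K) ∧ ¬ IsOuterForZeroSets (kochMeasure K)) ∧
        (∃ F : Set K, IsClosed F ∧ interior F = ∅ ∧ 0 < kochMeasure K F) ∧
        (∀ F : Set K, IsClosed F → interior F = ∅ → 0 < kochMeasure K F →
          chi F ∈ N1Infty (kochMeasure K) ∧
          ¬ WeaklyQuasicontinuous (kochMeasure K) (chi F))) := by

  refine ⟨fun P _ _ _ μ x₀ hμ hno hx₀ => newtonLInfty_of_almostNoRectCurves hμ hno hx₀, ?_⟩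
  intro K hK
  have hfrac : IsFractal kochDim K ∧ K.Nonempty := by
    rcases hK with rfl | rfl
    · exact ⟨isFractal_kochCurve, kochCurve_nonempty⟩
    · exact ⟨isFractal_kochSnowflake, kochCurve_nonempty.inl.inl⟩
  obtain ⟨hfr, x, hx⟩ := hfrac
  have hballs : BallsPosFinite (kochMeasure K) := hfr.ballsPosFinite kochDim_pos.le
  have hno : AlmostNoRectCurves (kochMeasure K) := hfr.noCurves.almostNoRectCurves _
  have hatoms : NullSingletonClass (kochMeasure K) :=
    Measure.nullSingletonClass_hausdorff K kochDim_pos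
  have hfin : IsFiniteMeasure (kochMeasure K) := hfr.isFiniteMeasure kochDim_pos.le
  -- Hausdorff measure of positive dimension has no atoms, so every point may serve as `x₀`.
  have hall := fun y : K => newtonLInfty_of_almostNoRectCurves hballs hno (measure_singleton y)
  obtain ⟨h1, h2, -, h4, h5⟩ := hall ⟨x, hx⟩
  exact ⟨hballs, hno, h1, h2, fun y => ⟨measure_singleton y, (hall y).2.2.1⟩, h4,
    exists_isClosed_interior_eq_empty _ (hfr.kochMeasure_pos ⟨x, hx⟩), h5⟩
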